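/- Let $p,q\ge 2$ be integers with $p+q$ even. On $\mathbb R^{p+q}\ni (x,y)$ let $\Xi=\{(x,y): |x|=|y|\}\setminus\{0\}$, $M=\{(x,y): |x|=|y|=1\}\simeq S^{p-1}\times S^{q-1}$, $\nu(x,y)=|x|$ on $\Xi$, and let $G=O(p,q)=\{g\in GL(p+q,\mathbb R): {}^tg\,I_{p,q}\,g=I_{p,q}\}$ act linearly on $\Xi$, and on $M\simeq \Xi/\mathbb R_{>0}$ by $L_hz=h z/\nu(h z)$. Let $$V^{p,q}=\{f\in C^\infty(M):\widetilde\Delta_Mf=0\},\qquad \widetilde\Delta_M=\Delta_{S^{p-1}}-\Delta_{S^{q-1}}-\tfrac{p+q-4}{4(p+q-3)}\bigl((p-1)(p-2)-(q-1)(q-2)\bigr),$$ be the kernel of the Yamabe operator of $M$ (with metric $g_{S^{p-1}}\oplus(-g_{S^{q-1}})$), and let $G$ act on $C^\infty(M)$ by $(\varpi(h^{-1})f)(z)=\nu(hz)^{-\frac{p+q-4}2}f(L_hz)$. Put $a=-\frac{p+q-4}2$, $\epsilon=(-1)^{\frac{p-q}2}$, and $$S^{a,\epsilon}(\Xi)=\{F\in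 C^\infty(\Xi): F(t\xi)=t^aF(\xi)\ (t>0),\ F(-\xi)=\epsilon F(\xi)\},$$ with $G$ acting by left translations. Then $V^{p,q}$ is $G$-stable, and the resulting representation $\varpi^{p,q}$ of $G$ on $V^{p,q}$ is a subrepresentation of $S^{a,\epsilon}(\Xi)$: there is an injective $G$-intertwining linear map $J:V^{p,q}\to S^{a,\epsilon}(\Xi)$ with $(Jf)|_M=f$ for all $f$. Equivalently, $\varpi^{p,q}$ is a subrepresentation of a degenerate principal series. Let $\xi^o={}^t(1,0,\dots,0,1)$, $E=E_{1,p+q}+E_{p+q,1}$, $A=\exp\mathbb RE$, $N=\exp\{X\in\mathfrak o(p,q):[E,X]=X\}$, let $M_+\simeq O(p-1,q-1)$ be the subgroup of $G$ fixing the first and the last standard basis vector, $m_0=-I_{p+q}$, $M^{\max}=M_+\cup m_0M_+$, $P^{\max}=M^{\max}AN$, $\rho=\frac{p+q-2}2$, and let $\chi_\epsilon$ be the character of $M^{\max}$ which is trivial on $M_+$ with $\chi_\epsilon(m_0)=\epsilon$. Let $$C^\infty\text{-}\mathrm{Ind}_{P^{\max}}^G(\chi_\epsilon\otimes\mathbb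 C_{-1})=\{f\in C^\infty(G): f(g\,m\,e^{tE}n)=\chi_\epsilon(m^{-1})e^{-t(-1+\rho)}f(g)\ \text{for all } g\in G,\ m\in M^{\max},\ t\in\mathbb R,\ n\in N\},$$ with $G$ acting by left translations. Then $F\mapsto(g\mapsto F(g\xi^o))$ is an isomorphism of $G$-representations $S^{a,\epsilon}(\Xi)\to C^\infty\text{-}\mathrm{Ind}_{P^{\max}}^G(\chi_\epsilon\otimes\mathbb C_{-1})$, and its composition with $J$ is an injective $G$-intertwining map from $\varpi^{p,q}$ to $C^\infty\text{-}\mathrm{Ind}_{P^{\max}}^G(\chi_\epsilon\otimes\mathbb C_{-1})$. -/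

import Mathlib

open scoped ContDiff Matrix

noncomputable section

namespace OPQ

/-! ### Smooth functions on embedded submanifolds -/

section Smooth

variable {X E : Type*} [NormedAddCommGroup E] [NormedSpace ℝ E]

/-- For an embedding `ι : X → E` of a set `X` as a submanifold of the vector space `E`:
`f : X → ℂ` is smooth if near every point it is the restriction of a smooth function
on an open set of `E`. -/
def IsSmooth (ι : X → E) (f : X → ℂ) : Prop :=
  ∀ x : X, ∃ U : Set E, IsOpen U ∧ ι x ∈ U ∧
    ∃ F : E → ℂ, ContDiffOn ℝ ∞ F U ∧ ∀ y : X, ι y ∈ U → f y = F (ι y)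

/-- The complex vector space of smooth functions on `X`. -/
def smooth (ι : X → E) : Submodule ℂ (X → ℂ) where
  carrier := {f | IsSmooth ι f}
  zero_mem' := fun _ => ⟨Set.univ, isOpen_univ, trivial, fun _ => 0, contDiffOn_const,
    fun _ _ => rfl⟩
  add_mem' := by
    intro f g hf hg x
    obtain ⟨U, hU, hxU, F, hF, hfF⟩ := hf x
    obtain ⟨W, hW, hxW, H, hH, hgH⟩ := hg x
    refine ⟨U ∩ W, hU.inter hW, ⟨hxU, hxW⟩, fun v => F v + H v,
      (hF.mono Set.inter_subset_left).add (hH.mono Set.inter_subset_right), ?_⟩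
    intro y hy
    simp [hfF y hy.1, hgH y hy.2]
  smul_mem' := by
    intro c f hf x
    obtain ⟨U, hU, hxU, F, hF, hfF⟩ := hf x
    refine ⟨U, hU, hxU, fun v => c * F v, contDiffOn_const.mul hF, ?_⟩
    intro y hy
    simp [hfF y hy]

/-- Pull-back of a smooth function along a map which is the restriction of a smooth map. -/
theorem IsSmooth.comp {Y E' : Type*} [NormedAddCommGroup E'] [NormedSpace ℝ E']
    {ι : X → E} {κ : Y → E'} {f : X → ℂ} (hf : IsSmooth ι f) (φ : Y → X) (Φ : E' → E)
    (hΦ : ∀ y, ∃ U : Set E', IsOpen U ∧ κ y ∈ U ∧ ContDiffOn ℝ ∞ Φ U)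
    (h : ∀ y, ι (φ y) = Φ (κ y)) : IsSmooth κ (fun y => f (φ y)) := by
  intro y
  obtain ⟨U, hU, hxU, F, hF, hfF⟩ := hf (φ y)
  obtain ⟨W, hW, hyW, hΦW⟩ := hΦ y
  refine ⟨W ∩ Φ ⁻¹' U, hΦW.continuousOn.isOpen_inter_preimage hW hU,
    ⟨hyW, by simpa [← h] using hxU⟩, fun v => F (Φ v),
    hF.comp (hΦW.mono Set.inter_subset_left) (fun v hv => hv.2), ?_⟩
  intro z hz
  have := hfF (φ z) (by rw [h]; exact hz.2)
  simpa [h] using this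

theorem IsSmooth.mul {ι : X → E} {f g : X → ℂ} (hf : IsSmooth ι f) (hg : IsSmooth ι g) :
    IsSmooth ι (fun x => f x * g x) := by
  intro x
  obtain ⟨U, hU, hxU, F, hF, hfF⟩ := hf x
  obtain ⟨W, hW, hxW, H, hH, hgH⟩ := hg x
  refine ⟨U ∩ W, hU.inter hW, ⟨hxU, hxW⟩, fun v => F v * H v,
    (hF.mono Set.inter_subset_left).mul (hH.mono Set.inter_subset_right), ?_⟩
  intro y hy
  simp [hfF y hy.1, hgH y hy.2]

end Smooth

/-! ### The space `ℝ^{p,q}`, the light cone `Ξ`, the product of spheres `M` -/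

/-- `ℝ^{p+q}` with coordinates `(x, y) = (x₁, …, x_p, y₁, …, y_q)`. -/
abbrev Space (p q : ℕ) : Type := Fin p ⊕ Fin q → ℝ

abbrev Mat (p q : ℕ) : Type := Matrix (Fin p ⊕ Fin q) (Fin p ⊕ Fin q) ℝ

variable {p q : ℕ}

/-- The Euclidean norm `|x|` of the first component of `z = (x, y)`. -/
def normX (z : Space p q) : ℝ := √(∑ i, z (Sum.inl i) ^ 2)

/-- The Euclidean norm `|y|` of the second component of `z = (x, y)`. -/
def normY (z : Space p q) : ℝ := √(∑ j, z (Sum.inr j) ^ 2)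

variable (p q) in
/-- The light cone `Ξ`. -/
def cone : Set (Space p q) := {z | normX z = normY z} \ {0}

variable (p q) in
/-- `M = S^{p-1} × S^{q-1}`. -/
def spheres : Set (Space p q) := {z | normX z = 1 ∧ normY z = 1}

variable (p q) in
/-- `C^∞(M)`. -/
abbrev SmoothM : Submodule ℂ (spheres p q → ℂ) :=
  smooth (Subtype.val : spheres p q → Space p q)

/-- `(x, y) ↦ (x/|x|, y/|y|)`. -/
def radial (z : Space p q) : Space p q :=
  Sum.elim (fun i => z (Sum.inl i) / normX z) (fun j => z (Sum.inr j) / normY z)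

/-- The function `ν(x, y) = |x|` (which is also `|y|` on the light cone). -/
abbrev nu (z : Space p q) : ℝ := normX z

/-! ### The group `O(p,q)` and its Lie algebra -/

variable (p q) in
/-- `I_{p,q} = diag(1, …, 1, -1, …, -1)`. -/
abbrev Ipq : Mat p q := LieAlgebra.Orthogonal.indefiniteDiagonal (Fin p) (Fin q) ℝ

variable (p q) in
/-- The indefinite orthogonal group `O(p,q)`. -/
def G : Subgroup (GL (Fin p ⊕ Fin q) ℝ) where
  carrier := {g | (g : Mat p q)ᵀ * Ipq p q * (g : Mat p q) = Ipq p q}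
  one_mem' := by simp
  mul_mem' := by
    intro a b ha hb
    simp only [Set.mem_ofPred_eq, Units.val_mul, Matrix.transpose_mul] at *
    calc _ = (b : Mat p q)ᵀ * ((a : Mat p q)ᵀ * Ipq p q * (a : Mat p q)) * (b : Mat p q) := by
          simp only [mul_assoc]
      _ = _ := by rw [ha, hb]
  inv_mem' := by
    intro a ha
    simp only [Set.mem_ofPred_eq] at *
    have h1 : (a : Mat p q) * ((a⁻¹ : GL _ ℝ) : Mat p q) = 1 := by
      rw [← Units.val_mul]; simp
    have h2 : ((a⁻¹ : GL _ ℝ) : Mat p q)ᵀ * (a : Mat p q)ᵀ = 1 := by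
      rw [← Matrix.transpose_mul, h1, Matrix.transpose_one]
    calc _ = ((a⁻¹ : GL _ ℝ) : Mat p q)ᵀ * ((a : Mat p q)ᵀ * Ipq p q * (a : Mat p q))
            * ((a⁻¹ : GL _ ℝ) : Mat p q) := by rw [ha]
      _ = (((a⁻¹ : GL _ ℝ) : Mat p q)ᵀ * (a : Mat p q)ᵀ) * Ipq p q
            * ((a : Mat p q) * ((a⁻¹ : GL _ ℝ) : Mat p q)) := by simp only [mul_assoc]
      _ = _ := by rw [h1, h2]; simp

/-- The matrix of an element of `O(p,q)`. -/
abbrev mat (g : G p q) : Mat p q := ((g : GL (Fin p ⊕ Fin q) ℝ) : Mat p q)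

variable (p q) in
/-- The entries of a matrix in `O(p,q)`; this embeds `O(p,q)` in a vector space. -/
def entries (g : G p q) : Fin p ⊕ Fin q → Fin p ⊕ Fin q → ℝ := fun i j => mat g i j

variable (p q) in
/-- `C^∞(G)`. -/
abbrev SmoothG : Submodule ℂ (G p q → ℂ) := smooth (entries p q)

variable (p q) in
/-- The Lie algebra `𝔤₀ = 𝔬(p,q)`. -/
def lieAlg : Set (Mat p q) := {X | Xᵀ * Ipq p q + Ipq p q * X = 0}

/-- The exponential map `𝔤₀ → G`. -/
def expG (X : Mat p q) (hX : X ∈ lieAlg p q) : G p q :=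
  ⟨(Matrix.isUnit_exp X).unit, by
    have hI : Ipq p q * Ipq p q = 1 := by
      unfold Ipq LieAlgebra.Orthogonal.indefiniteDiagonal
      rw [Matrix.diagonal_mul_diagonal, ← Matrix.diagonal_one]
      congr 1
      funext k
      cases k <;> simp
    have hu : IsUnit (Ipq p q) := IsUnit.of_mul_eq_one _ hI
    have hinv : (Ipq p q)⁻¹ = Ipq p q := Matrix.inv_eq_left_inv hI
    have hXt : Xᵀ = Ipq p q * (-X) * (Ipq p q)⁻¹ := by
      have h : Xᵀ * Ipq p q = Ipq p q * (-X) := by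
        rw [mul_neg]; exact eq_neg_of_add_eq_zero_left hX
      rw [← h, hinv, mul_assoc, hI, mul_one]
    change (NormedSpace.exp X)ᵀ * Ipq p q * NormedSpace.exp X = Ipq p q
    rw [← Matrix.exp_transpose, hXt, Matrix.exp_conj _ _ hu, Matrix.exp_neg, hinv]
    have h3 : (NormedSpace.exp X)⁻¹ * NormedSpace.exp X = 1 :=
      Matrix.nonsing_inv_mul _ ((Matrix.isUnit_iff_isUnit_det _).1 (Matrix.isUnit_exp X))
    rw [mul_assoc _ (Ipq p q) (Ipq p q), hI, mul_one, mul_assoc, h3, mul_one]⟩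

/-! ### The actions of `O(p,q)` on the light cone and on `M` -/

theorem form_eq (z : Space p q) : z ⬝ᵥ (Ipq p q *ᵥ z) = normX z ^ 2 - normY z ^ 2 := by
  rw [normX, normY, Real.sq_sqrt (Finset.sum_nonneg fun _ _ => sq_nonneg _),
    Real.sq_sqrt (Finset.sum_nonneg fun _ _ => sq_nonneg _)]
  simp [LieAlgebra.Orthogonal.indefiniteDiagonal, Matrix.mulVec_diagonal, dotProduct,
    Fintype.sum_sum_type, pow_two, sub_eq_add_neg]

theorem normX_nonneg (z : Space p q) : 0 ≤ normX z := Real.sqrt_nonneg _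

theorem normY_nonneg (z : Space p q) : 0 ≤ normY z := Real.sqrt_nonneg _

theorem form_mulVec (g : G p q) (z : Space p q) :
    (mat g *ᵥ z) ⬝ᵥ (Ipq p q *ᵥ (mat g *ᵥ z)) = z ⬝ᵥ (Ipq p q *ᵥ z) := by
  have h : (mat g)ᵀ * Ipq p q * mat g = Ipq p q := g.2
  conv_rhs => rw [← h]
  rw [← Matrix.mulVec_mulVec, ← Matrix.mulVec_mulVec, Matrix.dotProduct_mulVec z,
    Matrix.vecMul_transpose]

theorem mat_mul_inv (g : G p q) : mat g * mat g⁻¹ = 1 := by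
  simp [mat]

theorem mat_inv_mul (g : G p q) : mat g⁻¹ * mat g = 1 := by
  simp [mat]

theorem mulVec_mem_cone (g : G p q) {z : Space p q} (hz : z ∈ cone p q) :
    mat g *ᵥ z ∈ cone p q := by
  refine ⟨?_, ?_⟩
  · have h := form_mulVec g z
    have hz1 : normX z = normY z := hz.1
    rw [form_eq, form_eq, hz1] at h
    have h2 : normX (mat g *ᵥ z) ^ 2 = normY (mat g *ᵥ z) ^ 2 := by linarith
    exact (pow_left_inj₀ (normX_nonneg _) (normY_nonneg _) two_ne_zero).1 h2
  · intro h0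
    have h0' : mat g *ᵥ z = 0 := h0
    apply hz.2
    have : mat g⁻¹ *ᵥ (mat g *ᵥ z) = z := by
      rw [Matrix.mulVec_mulVec, mat_inv_mul, Matrix.one_mulVec]
    rw [Set.mem_singleton_iff, ← this, h0', Matrix.mulVec_zero]

/-- The action of `G` on the light cone by the natural representation. -/
instance : MulAction (G p q) (cone p q) where
  smul g ξ := ⟨mat g *ᵥ (ξ : Space p q), mulVec_mem_cone g ξ.2⟩
  one_smul ξ := Subtype.ext (by
    change mat (1 : G p q) *ᵥ (ξ : Space p q) = ξ
    simp [mat])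
  mul_smul g h ξ := Subtype.ext (by
    change mat (g * h) *ᵥ (ξ : Space p q) = mat g *ᵥ (mat h *ᵥ (ξ : Space p q))
    simp [mat, Matrix.mulVec_mulVec])

theorem coe_smul (g : G p q) (ξ : cone p q) :
    ((g • ξ : cone p q) : Space p q) = mat g *ᵥ (ξ : Space p q) := rfl

theorem normX_pos (ξ : cone p q) : 0 < normX (ξ : Space p q) := by
  rcases (normX_nonneg (ξ : Space p q)).lt_or_eq with h | h
  · exact h
  · exfalso
    have hy : normY (ξ : Space p q) = 0 := by rw [← show _ = _ from ξ.2.1, ← h]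
    have hx : normX (ξ : Space p q) = 0 := h.symm
    apply ξ.2.2
    rw [normX, Real.sqrt_eq_zero (Finset.sum_nonneg fun _ _ => sq_nonneg _),
      Finset.sum_eq_zero_iff_of_nonneg (fun _ _ => sq_nonneg _)] at hx
    rw [normY, Real.sqrt_eq_zero (Finset.sum_nonneg fun _ _ => sq_nonneg _),
      Finset.sum_eq_zero_iff_of_nonneg (fun _ _ => sq_nonneg _)] at hy
    funext k
    cases k with
    | inl i => simpa using hx i (Finset.mem_univ i)
    | inr j => simpa using hy j (Finset.mem_univ j)

theorem normX_smul {t : ℝ} (ht : 0 ≤ t) (z : Space p q) : normX (t • z) = t * normX z := by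
  simp only [normX, Pi.smul_apply, smul_eq_mul, mul_pow, ← Finset.mul_sum]
  rw [Real.sqrt_mul (sq_nonneg t), Real.sqrt_sq ht]

theorem normY_smul {t : ℝ} (ht : 0 ≤ t) (z : Space p q) : normY (t • z) = t * normY z := by
  simp only [normY, Pi.smul_apply, smul_eq_mul, mul_pow, ← Finset.mul_sum]
  rw [Real.sqrt_mul (sq_nonneg t), Real.sqrt_sq ht]

/-- The dilation `ξ ↦ t ξ` of the light cone, `t > 0`. -/
def dilate (t : ℝ) (ht : 0 < t) (ξ : cone p q) : cone p q :=
  ⟨t • (ξ : Space p q), by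
    refine ⟨?_, ?_⟩
    · have h : normX (ξ : Space p q) = normY (ξ : Space p q) := ξ.2.1
      change normX _ = normY _
      rw [normX_smul ht.le, normY_smul ht.le, h]
    · intro h
      exact ξ.2.2 ((smul_eq_zero.1 (show t • (ξ : Space p q) = 0 from h)).resolve_left ht.ne')⟩

/-- The map `ξ ↦ -ξ` of the light cone. -/
def negCone (ξ : cone p q) : cone p q :=
  ⟨-(ξ : Space p q), by
    refine ⟨?_, ?_⟩
    · have h : normX (ξ : Space p q) = normY (ξ : Space p q) := ξ.2.1
      simpa [normX, normY] using h
    · intro h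
      exact ξ.2.2 (neg_eq_zero.1 (show -(ξ : Space p q) = 0 from h))⟩

/-- The inclusion `M ⊂ Ξ`. -/
def toCone (z : spheres p q) : cone p q :=
  ⟨z, by
    refine ⟨?_, ?_⟩
    · exact z.2.1.trans z.2.2.symm
    · intro h
      have h1 : normX (z : Space p q) = 1 := z.2.1
      rw [show (z : Space p q) = 0 from h] at h1
      simp [normX] at h1⟩

theorem radial_eq (ξ : cone p q) :
    radial (ξ : Space p q) = (nu (ξ : Space p q))⁻¹ • (ξ : Space p q) := by
  have h : normX (ξ : Space p q) = normY (ξ : Space p q) := ξ.2.1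
  funext k
  cases k with
  | inl i => simp [radial, nu, div_eq_inv_mul]
  | inr j => simp [radial, nu, div_eq_inv_mul, h]

/-- The projection `Φ : Ξ → M`, `(x, y) ↦ (x/|x|, y/|y|)`. -/
def proj (ξ : cone p q) : spheres p q :=
  ⟨radial (ξ : Space p q), by
    have h0 := normX_pos ξ
    have h : normX (ξ : Space p q) = normY (ξ : Space p q) := ξ.2.1
    rw [radial_eq]
    refine ⟨?_, ?_⟩
    · rw [normX_smul (inv_nonneg.2 h0.le), inv_mul_cancel₀ h0.ne']
    · rw [normY_smul (inv_nonneg.2 h0.le), ← h, inv_mul_cancel₀ h0.ne']⟩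

/-- The action `L_h` of `h ∈ G` on `M ≃ Ξ / ℝ₊`. -/
def L (h : G p q) (z : spheres p q) : spheres p q := proj (h • toCone z)

/-- The twisting factor `ν(h · z)`, `h ∈ G`, `z ∈ M`. -/
def nuAct (h : G p q) (z : spheres p q) : ℝ := nu ((h • toCone z : cone p q) : Space p q)

theorem nuAct_pos (h : G p q) (z : spheres p q) : 0 < nuAct h z := normX_pos _

theorem smul_dilate (g : G p q) (t : ℝ) (ht : 0 < t) (ξ : cone p q) :
    g • dilate t ht ξ = dilate t ht (g • ξ) := by
  apply Subtype.ext
  rw [coe_smul]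
  exact Matrix.mulVec_smul _ _ _

theorem smul_negCone (g : G p q) (ξ : cone p q) : g • negCone ξ = negCone (g • ξ) := by
  apply Subtype.ext
  rw [coe_smul]
  exact Matrix.mulVec_neg _ _

theorem toCone_proj (ξ : cone p q) :
    toCone (proj ξ) = dilate (nu (ξ : Space p q))⁻¹ (inv_pos.2 (normX_pos ξ)) ξ :=
  Subtype.ext (radial_eq ξ)

theorem proj_toCone (z : spheres p q) : proj (toCone z) = z := by
  apply Subtype.ext
  change radial ((toCone z : cone p q) : Space p q) = z
  rw [radial_eq]
  change (normX (z : Space p q))⁻¹ • (z : Space p q) = z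
  rw [show normX (z : Space p q) = 1 from z.2.1]
  simp

theorem proj_dilate (t : ℝ) (ht : 0 < t) (ξ : cone p q) : proj (dilate t ht ξ) = proj ξ := by
  apply Subtype.ext
  change radial ((dilate t ht ξ : cone p q) : Space p q) = radial (ξ : Space p q)
  rw [radial_eq, radial_eq]
  change (normX (t • (ξ : Space p q)))⁻¹ • t • (ξ : Space p q) = _
  rw [normX_smul ht.le, smul_smul]
  congr 1
  have := (normX_pos ξ).ne'
  field_simp

theorem L_one (z : spheres p q) : L 1 z = z := by
  rw [L, one_smul, proj_toCone]

theorem L_mul (g h : G p q) (z : spheres p q) : L (g * h) z = L g (L h z) := by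
  rw [L, L, L, toCone_proj, smul_dilate, proj_dilate, mul_smul]

theorem nuAct_one (z : spheres p q) : nuAct 1 z = 1 := by
  rw [nuAct, one_smul]; exact z.2.1

theorem nuAct_mul (g h : G p q) (z : spheres p q) :
    nuAct (g * h) z = nuAct g (L h z) * nuAct h z := by
  rw [nuAct, nuAct, L, toCone_proj, smul_dilate, mul_smul]
  change _ = normX ((nu ((h • toCone z : cone p q) : Space p q))⁻¹ •
    ((g • h • toCone z : cone p q) : Space p q)) * _
  have h0 := normX_pos (h • toCone z)
  rw [normX_smul (inv_nonneg.2 h0.le), nuAct]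
  have := h0.ne'
  simp only [nu] at *
  field_simp

/-! ### The representations `ϖ_λ` on `C^∞(M)` -/

theorem contDiff_mulVec (A : Mat p q) : ContDiff ℝ ∞ (fun v : Space p q => A *ᵥ v) :=
  (Matrix.mulVecLin A).toContinuousLinearMap.contDiff

theorem contDiffOn_normX : ContDiffOn ℝ ∞ (normX : Space p q → ℝ) {v | 0 < normX v} := by
  intro v hv
  have hv' : 0 < normX v := hv
  refine ContDiffAt.contDiffWithinAt ?_
  refine ContDiffAt.sqrt (ContDiff.contDiffAt (by fun_prop)) ?_
  intro h
  rw [normX, h, Real.sqrt_zero] at hv'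
  exact lt_irrefl _ hv'

theorem continuous_normX : Continuous (normX : Space p q → ℝ) := by
  unfold normX; fun_prop

theorem continuous_normY : Continuous (normY : Space p q → ℝ) := by
  unfold normY; fun_prop

/-- The operator `(T f)(z) = ν(h · z)^{-λ} f(L_h z)` preserves smoothness. -/
theorem smooth_twist (lam : ℂ) (h : G p q) {f : spheres p q → ℂ} (hf : f ∈ SmoothM p q) :
    (fun z => ((nuAct h z : ℝ) : ℂ) ^ (-lam) * f (L h z)) ∈ SmoothM p q := by
  set W : Set (Space p q) := {v | 0 < normX (mat h *ᵥ v)} with hWdef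
  have hW : IsOpen W :=
    isOpen_lt continuous_const (continuous_normX.comp (contDiff_mulVec (mat h)).continuous)
  have hmem : ∀ z : spheres p q, (z : Space p q) ∈ W := fun z => nuAct_pos h z
  have hN : ContDiffOn ℝ ∞ (fun v : Space p q => normX (mat h *ᵥ v)) W :=
    contDiffOn_normX.comp (contDiff_mulVec (mat h)).contDiffOn (fun v hv => hv)
  refine IsSmooth.mul ?_ ?_
  · intro z
    refine ⟨W, hW, hmem z, fun v => Complex.exp ((Real.log (normX (mat h *ᵥ v)) : ℂ) * -lam),
      ?_, ?_⟩
    · have h1 : ContDiffOn ℝ ∞ (fun v : Space p q => Real.log (normX (mat h *ᵥ v))) W :=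
        hN.log (fun v hv => ne_of_gt hv)
      have h2 : ContDiffOn ℝ ∞
          (fun v : Space p q => ((Real.log (normX (mat h *ᵥ v)) : ℝ) : ℂ)) W :=
        Complex.ofRealCLM.contDiff.comp_contDiffOn h1
      exact (h2.mul contDiffOn_const).cexp
    · intro y _
      have hpos := nuAct_pos h y
      change ((nuAct h y : ℝ) : ℂ) ^ (-lam) = _
      rw [Complex.cpow_def_of_ne_zero (by exact_mod_cast hpos.ne'), ← Complex.ofReal_log hpos.le]
      rfl
  · refine IsSmooth.comp (f := f) hf (L h)
      (fun v => (normX (mat h *ᵥ v))⁻¹ • (mat h *ᵥ v)) (fun z => ⟨W, hW, hmem z, ?_⟩) ?_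
    · exact (hN.inv (fun v hv => ne_of_gt hv)).smul (contDiff_mulVec (mat h)).contDiffOn
    · intro z
      exact radial_eq (h • toCone z)

variable (p q) in
/-- The representation `ϖ_λ` of `G` on `C^∞(M)`:
`(ϖ_λ(h⁻¹) f)(z) = ν(h · z)^{-λ} f(L_h z)`. -/
def varpi (lam : ℂ) : Representation ℂ (G p q) (SmoothM p q) where
  toFun h :=
    { toFun := fun f =>
        ⟨fun z => ((nuAct h⁻¹ z : ℝ) : ℂ) ^ (-lam) * (f : spheres p q → ℂ) (L h⁻¹ z),
          smooth_twist lam h⁻¹ f.2⟩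
      map_add' := fun f g => Subtype.ext (funext fun z => by simp [mul_add])
      map_smul' := fun c f => Subtype.ext (funext fun z => by simp [mul_left_comm]) }
  map_one' := by
    refine LinearMap.ext fun f => Subtype.ext (funext fun z => ?_)
    simp [nuAct_one, L_one]
  map_mul' g h := by
    refine LinearMap.ext fun f => Subtype.ext (funext fun z => ?_)
    simp only [mul_inv_rev, LinearMap.coe_mk, AddHom.coe_mk, Module.End.mul_apply]
    rw [nuAct_mul, L_mul, Complex.ofReal_mul,
      Complex.mul_cpow_ofReal_nonneg (nuAct_pos _ _).le (nuAct_pos _ _).le]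
    ring

/-! ### The Yamabe operator on `M = S^{p-1} × S^{q-1}` and the space `V^{p,q}` -/

open Classical in
/-- The extension of a function on `M` to `{x ≠ 0, y ≠ 0}` which is homogeneous of degree `0`
in `x` and in `y`: `(x, y) ↦ f(x/|x|, y/|y|)`. -/
def extend (f : spheres p q → ℂ) (z : Space p q) : ℂ :=
  if h : radial z ∈ spheres p q then f ⟨radial z, h⟩ else 0

/-- The second partial derivative `∂²F/∂z_k²` at `z`. -/
def partial2 (k : Fin p ⊕ Fin q) (F : Space p q → ℂ) (z : Space p q) : ℂ :=
  iteratedDeriv 2 (fun t : ℝ => F (z + t • Pi.single k 1)) 0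

/-- The Laplace-Beltrami operator `Δ_{S^{p-1}}` of the unit sphere, acting on the first
variable of functions on `M`: the Euclidean Laplacian in `x` of the extension of `f` which is
homogeneous of degree `0`, evaluated on the sphere. -/
def lapX (f : spheres p q → ℂ) (z : spheres p q) : ℂ :=
  ∑ i : Fin p, partial2 (Sum.inl i) (extend f) z

/-- The Laplace-Beltrami operator `Δ_{S^{q-1}}` acting on the second variable. -/
def lapY (f : spheres p q → ℂ) (z : spheres p q) : ℂ :=
  ∑ j : Fin q, partial2 (Sum.inr j) (extend f) z

/-- The Yamabe operator `Δ_M - (n-2)/(4(n-1)) K_M` of `M = S^{p-1} × S^{q-1}` with the metric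
`g_{S^{p-1}} ⊕ (-g_{S^{q-1}})`; here `n = p + q - 2`, `Δ_M = Δ_{S^{p-1}} - Δ_{S^{q-1}}`, and
the scalar curvature is `K_M = (p-1)(p-2) - (q-1)(q-2)`. -/
def yamabe (f : spheres p q → ℂ) (z : spheres p q) : ℂ :=
  lapX f z - lapY f z -
    ((p : ℂ) + q - 4) / (4 * ((p : ℂ) + q - 3)) *
      (((p : ℂ) - 1) * (p - 2) - ((q : ℂ) - 1) * (q - 2)) * f z

theorem normX_pos_of_mem (z : spheres p q) : 0 < normX (z : Space p q) := by
  rw [show normX (z : Space p q) = 1 from z.2.1]; exact one_pos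

theorem normY_pos_of_mem (z : spheres p q) : 0 < normY (z : Space p q) := by
  rw [show normY (z : Space p q) = 1 from z.2.2]; exact one_pos

theorem radial_mem {v : Space p q} (hx : 0 < normX v) (hy : 0 < normY v) :
    radial v ∈ spheres p q := by
  refine ⟨?_, ?_⟩
  · have h : normX (radial v) = normX ((normX v)⁻¹ • v) := by
      simp [normX, radial, div_eq_inv_mul]
    rw [h, normX_smul (inv_nonneg.2 hx.le), inv_mul_cancel₀ hx.ne']
  · have h : normY (radial v) = normY ((normY v)⁻¹ • v) := by
      simp [normY, radial, div_eq_inv_mul]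
    rw [h, normY_smul (inv_nonneg.2 hy.le), inv_mul_cancel₀ hy.ne']

theorem contDiffAt_radial {v : Space p q} (hx : 0 < normX v) (hy : 0 < normY v) :
    ContDiffAt ℝ ∞ (radial : Space p q → Space p q) v := by
  have hX : ContDiffAt ℝ ∞ (normX : Space p q → ℝ) v := by
    refine ContDiffAt.sqrt (ContDiff.contDiffAt (by fun_prop)) ?_
    intro h
    rw [normX, h, Real.sqrt_zero] at hx
    exact lt_irrefl _ hx
  have hY : ContDiffAt ℝ ∞ (normY : Space p q → ℝ) v := by
    refine ContDiffAt.sqrt (ContDiff.contDiffAt (by fun_prop)) ?_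
    intro h
    rw [normY, h, Real.sqrt_zero] at hy
    exact lt_irrefl _ hy
  rw [contDiffAt_pi]
  intro k
  cases k with
  | inl i => exact (ContDiff.contDiffAt (by fun_prop)).div hX hx.ne'
  | inr j => exact (ContDiff.contDiffAt (by fun_prop)).div hY hy.ne'

/-- The extension of a smooth function on `M` is smooth near `M`. -/
theorem contDiffAt_extend {f : spheres p q → ℂ} (hf : f ∈ SmoothM p q) (z : spheres p q) :
    ContDiffAt ℝ ∞ (extend f) (z : Space p q) := by
  have hx := normX_pos_of_mem z
  have hy := normY_pos_of_mem z
  have hrz : radial (z : Space p q) = z := by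
    have := congrArg Subtype.val (proj_toCone z)
    exact this
  obtain ⟨U, hU, hzU, F, hF, hfF⟩ := hf z
  have hr := contDiffAt_radial hx hy
  have hFz : ContDiffAt ℝ ∞ F (radial (z : Space p q)) := by
    rw [hrz]; exact hF.contDiffAt (hU.mem_nhds hzU)
  refine (hFz.comp (z : Space p q) hr).congr_of_eventuallyEq ?_
  have e1 : ∀ᶠ v in nhds (z : Space p q), 0 < normX v :=
    continuous_normX.continuousAt.eventually_const_lt hx
  have e2 : ∀ᶠ v in nhds (z : Space p q), 0 < normY v :=
    continuous_normY.continuousAt.eventually_const_lt hy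
  have e3 : ∀ᶠ v in nhds (z : Space p q), radial v ∈ U :=
    hr.continuousAt.eventually (by rw [hrz]; exact hU.mem_nhds hzU)
  filter_upwards [e1, e2, e3] with v h1 h2 h3
  rw [extend, dif_pos (radial_mem h1 h2)]
  exact hfF _ h3

theorem contDiffAt_line {f : spheres p q → ℂ} (hf : f ∈ SmoothM p q) (z : spheres p q)
    (k : Fin p ⊕ Fin q) :
    ContDiffAt ℝ 2 (fun t : ℝ => extend f ((z : Space p q) + t • Pi.single k 1)) 0 := by
  have h : ContDiffAt ℝ 2 (extend f) ((z : Space p q) + (0 : ℝ) • Pi.single k 1) := by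
    rw [zero_smul, add_zero]
    exact (contDiffAt_extend hf z).of_le (WithTop.coe_le_coe.2 le_top)
  have hl : ContDiff ℝ 2 (fun t : ℝ => (z : Space p q) + t • (Pi.single k 1 : Space p q)) :=
    contDiff_const.add (contDiff_id.smul contDiff_const)
  exact ContDiffAt.comp (f := fun t : ℝ => (z : Space p q) + t • (Pi.single k 1 : Space p q))
    (0 : ℝ) h hl.contDiffAt

theorem extend_add (f g : spheres p q → ℂ) (v : Space p q) :
    extend (f + g) v = extend f v + extend g v := by
  unfold extend; split_ifs <;> simp

theorem extend_smul (c : ℂ) (f : spheres p q → ℂ) (v : Space p q) :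
    extend (c • f) v = c • extend f v := by
  unfold extend; split_ifs <;> simp

theorem partial2_add {f g : spheres p q → ℂ} (hf : f ∈ SmoothM p q) (hg : g ∈ SmoothM p q)
    (z : spheres p q) (k : Fin p ⊕ Fin q) :
    partial2 k (extend (f + g)) z = partial2 k (extend f) z + partial2 k (extend g) z := by
  unfold partial2
  simp only [extend_add]
  exact iteratedDeriv_fun_add (contDiffAt_line hf z k) (contDiffAt_line hg z k)

theorem partial2_smul {f : spheres p q → ℂ} (hf : f ∈ SmoothM p q) (c : ℂ)
    (z : spheres p q) (k : Fin p ⊕ Fin q) :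
    partial2 k (extend (c • f)) z = c * partial2 k (extend f) z := by
  unfold partial2
  simp only [extend_smul]
  exact iteratedDeriv_fun_const_smul (contDiffAt_line hf z k) c

variable (p q) in
/-- `V^{p,q}`: the kernel of the Yamabe operator in `C^∞(M)`. -/
def V : Submodule ℂ (SmoothM p q) where
  carrier := {f | ∀ z, yamabe (f : spheres p q → ℂ) z = 0}
  zero_mem' := by
    intro z
    simp [yamabe, lapX, lapY, partial2, extend]
  add_mem' := by
    intro f g hf hg z
    have h1 := hf z
    have h2 := hg z
    simp only [yamabe, lapX, lapY, Submodule.coe_add, Pi.add_apply,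
      partial2_add f.2 g.2, Finset.sum_add_distrib] at *
    linear_combination h1 + h2
  smul_mem' := by
    intro c f hf z
    have h1 := hf z
    simp only [yamabe, lapX, lapY, Submodule.coe_smul, Pi.smul_apply, smul_eq_mul,
      partial2_smul f.2, ← Finset.mul_sum] at *
    linear_combination c * h1

/-! ### The spaces `S^{a,ε}(Ξ)` of homogeneous functions on the light cone -/

variable (p q) in
/-- `S^{a,ε}(Ξ)`: the smooth functions on the light cone with `F(t ξ) = t^a F(ξ)` for `t > 0`
and `F(-ξ) = ε F(ξ)`. -/
def S (a : ℂ) (ε : ℤˣ) : Submodule ℂ (cone p q → ℂ) where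
  carrier := {F | F ∈ smooth (Subtype.val : cone p q → Space p q) ∧
    (∀ (t : ℝ) (ht : 0 < t) (ξ : cone p q), F (dilate t ht ξ) = (t : ℂ) ^ a * F ξ) ∧
    ∀ ξ : cone p q, F (negCone ξ) = ((ε : ℤ) : ℂ) * F ξ}
  zero_mem' := ⟨Submodule.zero_mem _, by simp, by simp⟩
  add_mem' := by
    rintro F H ⟨h1, h2, h3⟩ ⟨k1, k2, k3⟩
    refine ⟨Submodule.add_mem _ h1 k1, fun t ht ξ => ?_, fun ξ => ?_⟩
    · simp [h2, k2, mul_add]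
    · simp [h3, k3, mul_add]
  smul_mem' := by
    rintro c F ⟨h1, h2, h3⟩
    refine ⟨Submodule.smul_mem _ c h1, fun t ht ξ => ?_, fun ξ => ?_⟩
    · simp [h2, mul_left_comm]
    · simp [h3, mul_left_comm]

theorem translate_mem_S {a : ℂ} {ε : ℤˣ} (g : G p q) {F : cone p q → ℂ} (hF : F ∈ S p q a ε) :
    (fun ξ => F (g • ξ)) ∈ S p q a ε := by
  refine ⟨?_, fun t ht ξ => ?_, fun ξ => ?_⟩
  · exact IsSmooth.comp (f := F) hF.1 (fun ξ => g • ξ) (fun v => mat g *ᵥ v)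
      (fun ξ => ⟨Set.univ, isOpen_univ, trivial, (contDiff_mulVec _).contDiffOn⟩)
      (fun ξ => rfl)
  · simp only [smul_dilate, hF.2.1]
  · simp only [smul_negCone, hF.2.2]

variable (p q) in
/-- The representation of `G` on `S^{a,ε}(Ξ)` by left translations. -/
def coneRep (a : ℂ) (ε : ℤˣ) : Representation ℂ (G p q) (S p q a ε) where
  toFun g :=
    { toFun := fun F => ⟨fun ξ => (F : cone p q → ℂ) (g⁻¹ • ξ), translate_mem_S g⁻¹ F.2⟩
      map_add' := fun _ _ => rfl
      map_smul' := fun _ _ => rfl }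
  map_one' := by
    refine LinearMap.ext fun F => Subtype.ext (funext fun ξ => ?_)
    simp
  map_mul' g h := by
    refine LinearMap.ext fun F => Subtype.ext (funext fun ξ => ?_)
    simp [mul_smul]

/-! ### The maximal parabolic subgroup and the degenerate principal series -/

variable (p q) in
/-- `m₀ = -I_{p+q}`. -/
def m0 : G p q := ⟨-1, by
  change (-1 : Mat p q)ᵀ * Ipq p q * (-1 : Mat p q) = Ipq p q
  simp⟩

theorem m0_comm (g : G p q) : m0 p q * g = g * m0 p q := by
  apply Subtype.ext
  apply Units.ext
  change (-1 : Mat p q) * mat g = mat g * (-1)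
  simp

theorem m0_mul_self : m0 p q * m0 p q = 1 := by
  apply Subtype.ext
  apply Units.ext
  change (-1 : Mat p q) * (-1) = 1
  simp

section Parabolic

variable (p q) [NeZero p] [NeZero q]

/-- The index of the first coordinate `x₁`. -/
def first : Fin p ⊕ Fin q := Sum.inl 0

/-- The index of the last coordinate `y_q`. -/
def last : Fin p ⊕ Fin q := Sum.inr ⊤

/-- The base point `ξ° = ᵗ(1, 0, …, 0, 1)` of the light cone. -/
def base : cone p q :=
  ⟨Pi.single (first p q) 1 + Pi.single (last p q) 1, by
    refine ⟨?_, ?_⟩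
    · simp [normX, normY, first, last, Pi.single_apply, ite_pow]
    · intro h
      have := congrFun (show (Pi.single (first p q) 1 + Pi.single (last p q) 1 : Space p q) = 0
        from h) (first p q)
      simp [first, last] at this⟩

/-- `E = E_{1,p+q} + E_{p+q,1} ∈ 𝔤₀`. -/
def E : Mat p q :=
  Matrix.single (first p q) (last p q) 1 + Matrix.single (last p q) (first p q) 1

theorem smul_E_mem (t : ℝ) : t • E p q ∈ lieAlg p q := by
  have h : (E p q)ᵀ * Ipq p q + Ipq p q * E p q = 0 := by
    unfold Ipq LieAlgebra.Orthogonal.indefiniteDiagonal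
    ext i j
    rw [Matrix.add_apply, Matrix.mul_diagonal, Matrix.diagonal_mul]
    rcases i with i | i <;> rcases j with j | j <;>
      simp [E, first, last, Matrix.single_apply, and_comm]
    split_ifs <;> simp
  change (t • E p q)ᵀ * Ipq p q + Ipq p q * (t • E p q) = 0
  rw [Matrix.transpose_smul, smul_mul_assoc, mul_smul_comm, ← smul_add, h, smul_zero]

/-- The element `exp(t E)` of `A^max`. -/
def expE (t : ℝ) : G p q := expG (t • E p q) (smul_E_mem p q t)

/-- `N^max = exp(𝔫)`, where `𝔫 = {X ∈ 𝔤₀ : [E, X] = X}`. -/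
def Nmax : Set (G p q) :=
  {n | ∃ (X : Mat p q) (hX : X ∈ lieAlg p q), E p q * X - X * E p q = X ∧ n = expG X hX}

/-- `M₊^max ≃ O(p-1,q-1)`: the subgroup fixing the first and the last standard basis vector. -/
def Mplus : Subgroup (G p q) where
  carrier := {m | mat m *ᵥ Pi.single (first p q) 1 = Pi.single (first p q) 1 ∧
    mat m *ᵥ Pi.single (last p q) 1 = Pi.single (last p q) 1}
  one_mem' := by
    have h1 : mat (1 : G p q) = 1 := rfl
    simp only [Set.mem_ofPred_eq, h1, Matrix.one_mulVec, and_self]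
  mul_mem' := by
    rintro a b ⟨ha1, ha2⟩ ⟨hb1, hb2⟩
    have hab : mat (a * b) = mat a * mat b := rfl
    refine ⟨?_, ?_⟩
    · rw [hab, ← Matrix.mulVec_mulVec, hb1, ha1]
    · rw [hab, ← Matrix.mulVec_mulVec, hb2, ha2]
  inv_mem' := by
    rintro a ⟨ha1, ha2⟩
    refine ⟨?_, ?_⟩
    · conv_lhs => rw [← ha1]
      rw [Matrix.mulVec_mulVec, mat_inv_mul, Matrix.one_mulVec]
    · conv_lhs => rw [← ha2]
      rw [Matrix.mulVec_mulVec, mat_inv_mul, Matrix.one_mulVec]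

/-- `M^max`: the subgroup generated by `M₊^max` and `m₀`. -/
def Mmax : Subgroup (G p q) := Subgroup.closure (Mplus p q ∪ {m0 p q})

variable {p q}

theorem m0_not_mem : m0 p q ∉ Mplus p q := by
  intro h
  have h1 : (-1 : Mat p q) *ᵥ Pi.single (first p q) 1 = Pi.single (first p q) 1 := h.1
  have h2 := congrFun h1 (first p q)
  simp only [Matrix.neg_mulVec, Matrix.one_mulVec, Pi.neg_apply, Pi.single_eq_same] at h2
  norm_num at h2

theorem Mmax_cases {m : G p q} (hm : m ∈ Mmax p q) :
    m ∈ Mplus p q ∨ m0 p q * m ∈ Mplus p q := by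
  induction hm using Subgroup.closure_induction with
  | mem x hx =>
    rcases hx with hx | hx
    · exact Or.inl hx
    · right
      rw [show x = m0 p q from hx, m0_mul_self]
      exact one_mem _
  | one => exact Or.inl (one_mem _)
  | mul a b _ _ ha hb =>
    rcases ha with ha | ha <;> rcases hb with hb | hb
    · exact Or.inl (mul_mem ha hb)
    · right
      rw [← mul_assoc, m0_comm, mul_assoc]
      exact mul_mem ha hb
    · right
      rw [← mul_assoc]
      exact mul_mem ha hb
    · left
      have := mul_mem ha hb
      rwa [m0_comm a, mul_assoc, ← mul_assoc (m0 p q) (m0 p q), m0_mul_self, one_mul] at this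
  | inv a _ ha =>
    rcases ha with ha | ha
    · exact Or.inl (inv_mem ha)
    · right
      have := inv_mem ha
      rwa [mul_inv_rev, inv_eq_of_mul_eq_one_left m0_mul_self, ← m0_comm] at this

open Classical in
/-- The character `χ_ε : M^max → M^max / M₊^max ≃ {1, m₀} → {±1}` with `χ_ε(m₀) = ε`. -/
def chi (ε : ℤˣ) : Mmax p q →* ℤˣ where
  toFun m := if (m : G p q) ∈ Mplus p q then 1 else ε
  map_one' := by simp [one_mem]
  map_mul' a b := by
    have key : ∀ {x y : G p q}, m0 p q * x ∈ Mplus p q → m0 p q * y ∈ Mplus p q →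
        x * y ∈ Mplus p q := by
      intro x y hx hy
      have := mul_mem hx hy
      rwa [m0_comm x, mul_assoc, ← mul_assoc (m0 p q) (m0 p q), m0_mul_self, one_mul] at this
    by_cases ha : (a : G p q) ∈ Mplus p q <;> by_cases hb : (b : G p q) ∈ Mplus p q
    · simp [ha, hb, mul_mem]
    · simp [ha, hb, Subgroup.mul_mem_cancel_left]
    · simp [ha, hb, Subgroup.mul_mem_cancel_right]
    · have := key ((Mmax_cases a.2).resolve_left ha) ((Mmax_cases b.2).resolve_left hb)
      simp [ha, hb, this]

variable (p q) in
/-- `ρ = (p + q - 2)/2`. -/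
def rho : ℂ := ((p : ℂ) + q - 2) / 2

variable (p q) in
/-- The `C^∞`-valued degenerate principal series `C^∞-Ind_{P^max}^G(χ_ε ⊗ ℂ_λ)`, where
`P^max = M^max A^max N^max`: the smooth functions on `G` with
`f(g m a n) = χ_ε(m⁻¹) a^{-(λ+ρ)} f(g)`; here `a^μ = e^{tμ}` for `a = exp(t E)`. -/
def Ind (lam : ℂ) (ε : ℤˣ) : Submodule ℂ (G p q → ℂ) where
  carrier := {f | f ∈ SmoothG p q ∧
    ∀ (g : G p q) (m : Mmax p q) (t : ℝ), ∀ n ∈ Nmax p q,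
      f (g * m * expE p q t * n) =
        ((chi ε m⁻¹ : ℤ) : ℂ) * Complex.exp (t * -(lam + rho p q)) * f g}
  zero_mem' := ⟨Submodule.zero_mem _, by simp⟩
  add_mem' := by
    rintro f k ⟨h1, h2⟩ ⟨k1, k2⟩
    refine ⟨Submodule.add_mem _ h1 k1, fun g m t n hn => ?_⟩
    simp only [Pi.add_apply, h2 g m t n hn, k2 g m t n hn, mul_add]
  smul_mem' := by
    rintro c f ⟨h1, h2⟩
    refine ⟨Submodule.smul_mem _ c h1, fun g m t n hn => ?_⟩
    simp only [Pi.smul_apply, smul_eq_mul, h2 g m t n hn]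
    ring

theorem translate_mem_Ind {lam : ℂ} {ε : ℤˣ} (h : G p q) {f : G p q → ℂ}
    (hf : f ∈ Ind p q lam ε) : (fun g => f (h * g)) ∈ Ind p q lam ε := by
  refine ⟨?_, fun g m t n hn => ?_⟩
  · refine IsSmooth.comp (f := f) hf.1 (fun g => h * g)
      (fun v i j => ∑ k, mat h i k * v k j)
      (fun g => ⟨Set.univ, isOpen_univ, trivial, ContDiff.contDiffOn ?_⟩) (fun g => ?_)
    · fun_prop
    · funext i j
      change (mat h * mat g) i j = _
      rw [Matrix.mul_apply]
      rfl
  · have := hf.2 (h * g) m t n hn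
    simpa only [mul_assoc] using this

variable (p q) in
/-- The representation of `G` on the degenerate principal series by left translations. -/
def indRep (lam : ℂ) (ε : ℤˣ) : Representation ℂ (G p q) (Ind p q lam ε) where
  toFun h :=
    { toFun := fun f => ⟨fun g => (f : G p q → ℂ) (h⁻¹ * g), translate_mem_Ind h⁻¹ f.2⟩
      map_add' := fun _ _ => rfl
      map_smul' := fun _ _ => rfl }
  map_one' := by
    refine LinearMap.ext fun f => Subtype.ext (funext fun g => ?_)
    simp
  map_mul' g h := by
    refine LinearMap.ext fun f => Subtype.ext (funext fun x => ?_)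
    simp [mul_assoc]

end Parabolic

end OPQ

end

/-!
Put `a = -(p + q - 4) / 2`. The Yamabe operator of `M` is the restriction to `M` of the
ultrahyperbolic operator `□ = ∑ ∂²/∂x_i² - ∑ ∂²/∂y_j²` applied to the extension of a function to a
homogeneous function of degree `a`. Since `□` commutes with `O(p,q)`, the space `V^{p,q}` is stable,
and the homogeneous extension to `Ξ` intertwines the actions.

It remains to see that every `f ∈ V^{p,q}` satisfies `f (-z) = (-1) ^ ((p - q) / 2) * f z`. On a
product of spherical harmonics of degrees `m` and `n` the Yamabe equation reads
`(m + (p - 2) / 2) ^ 2 = (n + (q - 2) / 2) ^ 2`, hence `n - m = (p - q) / 2`, and `m + n` has the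
parity of `(p - q) / 2`. The decomposition of `f` is not needed: cut off near `M`, the part of `f`
which violates the claim integrates to zero against all products `l₁ ^ m * l₂ ^ n` of powers of
linear forms in `x` and in `y`. If `m + n` has the parity of `(p - q) / 2`, the integrand is odd;
otherwise the Laplacians, which are symmetric and for which such a product is an eigenfunction up
to terms of lower degree, allow induction on `m + n`. So the Fourier transform of this part is zero.

Finally, `O(p,q)` acts transitively on `Ξ`, the stabilizer of `ξ°` is `M₊ N`, and reflections give
smooth local sections of `g ↦ g ξ°`. Hence the functions on `O(p,q)` which transform under `M₊ N`
as required are the functions on `Ξ`, and the conditions for `A` and `m₀` become homogeneity and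
parity.
-/

noncomputable section

namespace OPQ

section LinearVectorFields

variable {E F : Type*} [NormedAddCommGroup E] [NormedSpace ℝ E] [NormedAddCommGroup F]
  [NormedSpace ℝ F]

theorem hasDerivAt_line (z v : E) (t : ℝ) : HasDerivAt (fun t : ℝ => z + t • v) v t := by
  simpa using ((hasDerivAt_id' t).smul_const v).const_add z

theorem iteratedDeriv_two_line {f : E → F} {z : E} (hf : ContDiffAt ℝ 2 f z) (v : E) :
    iteratedDeriv 2 (fun t : ℝ => f (z + t • v)) 0 = fderiv ℝ (fderiv ℝ f) z v v := by
  have hnear : ∀ᶠ t : ℝ in nhds 0, ContDiffAt ℝ 2 f (z + t • v) := by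
    refine (hasDerivAt_line z v 0).continuousAt.eventually ?_
    simpa using hf.eventually (by decide)
  have hderiv : deriv (fun t : ℝ => f (z + t • v)) =ᶠ[nhds 0]
      fun t => fderiv ℝ f (z + t • v) v := by
    filter_upwards [hnear] with t ht
    exact ((ht.differentiableAt two_ne_zero).hasFDerivAt.comp_hasDerivAt t
      (hasDerivAt_line z v t)).deriv
  have hdf : DifferentiableAt ℝ (fderiv ℝ f) z :=
    (hf.fderiv_right (m := 1) one_add_one_eq_two.le).differentiableAt one_ne_zero
  have h := (hdf.hasFDerivAt.comp_hasDerivAt_of_eq (0 : ℝ) (hasDerivAt_line z v 0)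
    (by simp)).clm_apply (hasDerivAt_const (0 : ℝ) v)
  rw [iteratedDeriv_succ, iteratedDeriv_one, hderiv.deriv_eq]
  simpa using h.deriv

theorem fderiv_eq_zero_of_eventually_const {f : E → F} {z v : E} (hf : DifferentiableAt ℝ f z)
    (h : ∀ᶠ t : ℝ in nhds 0, f (z + t • v) = f z) : fderiv ℝ f z v = 0 := by
  have hline : (fun t : ℝ => f (z + t • v)) =ᶠ[nhds 0] fun _ => f z := h
  rw [← hf.lineDeriv_eq_fderiv, lineDeriv, hline.deriv_eq, deriv_const]

theorem fderiv_fderiv_eq_zero_of_eventually_const {f : E → F} {z v : E}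
    (hf : ContDiffAt ℝ 2 f z) (h : ∀ᶠ t : ℝ in nhds 0, f (z + t • v) = f z) :
    fderiv ℝ (fderiv ℝ f) z v v = 0 := by
  have hline : (fun t : ℝ => f (z + t • v)) =ᶠ[nhds 0] fun _ => f z := h
  rw [← iteratedDeriv_two_line hf, iteratedDeriv_succ, iteratedDeriv_one, hline.deriv.deriv_eq]
  simp only [deriv_const', deriv_const]

theorem fderiv_fderiv_comp_clm {E' : Type*} [NormedAddCommGroup E'] [NormedSpace ℝ E'] {f : E → F}
    (A : E' →L[ℝ] E) {z : E'} (hf : ContDiffAt ℝ 2 f (A z)) (v w : E') :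
    fderiv ℝ (fderiv ℝ fun u => f (A u)) z v w = fderiv ℝ (fderiv ℝ f) (A z) (A v) (A w) := by
  have hfderiv : fderiv ℝ (fun u => f (A u)) =ᶠ[nhds z] fun u => (fderiv ℝ f (A u)).comp A := by
    filter_upwards [A.continuous.continuousAt.eventually (hf.eventually (by decide))] with u hu
    exact ((hu.differentiableAt two_ne_zero).hasFDerivAt.comp u A.hasFDerivAt).fderiv
  have hdf : DifferentiableAt ℝ (fderiv ℝ f) (A z) :=
    (hf.fderiv_right (m := 1) one_add_one_eq_two.le).differentiableAt one_ne_zero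
  have h : HasFDerivAt (fun u => (fderiv ℝ f (A u)).comp A) _ z :=
    (hdf.hasFDerivAt.comp z A.hasFDerivAt).clm_comp (hasFDerivAt_const A z)
  rw [hfderiv.fderiv_eq, h.fderiv]
  simp

/-- The derivative of `f` along the linear vector field `z ↦ A z`. -/
def lieDeriv (A : E →L[ℝ] E) (f : E → F) (z : E) : F := fderiv ℝ f z (A z)

theorem lieDeriv_zero (f : E → F) (z : E) : lieDeriv 0 f z = 0 := map_zero _

theorem contDiffAt_lieDeriv {m n : WithTop ℕ∞} {f : E → F} {z : E} (A : E →L[ℝ] E)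
    (hf : ContDiffAt ℝ m f z) (hmn : n + 1 ≤ m) : ContDiffAt ℝ n (lieDeriv A f) z :=
  (hf.fderiv_right hmn).clm_apply A.contDiff.contDiffAt

theorem differentiableAt_lieDeriv {f : E → F} {z : E} (A : E →L[ℝ] E)
    (hf : ContDiffAt ℝ 2 f z) : DifferentiableAt ℝ (lieDeriv A f) z :=
  (contDiffAt_lieDeriv A hf one_add_one_eq_two.le).differentiableAt one_ne_zero

theorem contDiff_lieDeriv {f : E → F} (A : E →L[ℝ] E) (hf : ContDiff ℝ ∞ f) :
    ContDiff ℝ ∞ (lieDeriv A f) :=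
  contDiff_iff_contDiffAt.2 fun _ => contDiffAt_lieDeriv A hf.contDiffAt le_rfl

theorem lieDeriv_congr {f g : E → F} {z : E} (A : E →L[ℝ] E) (h : f =ᶠ[nhds z] g) :
    lieDeriv A f =ᶠ[nhds z] lieDeriv A g := by
  filter_upwards [h.fderiv (𝕜 := ℝ)] with w hw
  rw [lieDeriv, lieDeriv, hw]

theorem fderiv_lieDeriv {f : E → F} {z : E} (A : E →L[ℝ] E) (hf : ContDiffAt ℝ 2 f z) (v : E) :
    fderiv ℝ (lieDeriv A f) z v = fderiv ℝ (fderiv ℝ f) z v (A z) + fderiv ℝ f z (A v) := by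
  have hdf : DifferentiableAt ℝ (fderiv ℝ f) z :=
    (hf.fderiv_right (m := 1) one_add_one_eq_two.le).differentiableAt one_ne_zero
  have h := (hdf.hasFDerivAt.clm_apply A.hasFDerivAt).fderiv
  change fderiv ℝ (fun w => fderiv ℝ f w (A w)) z v = _
  rw [h]
  simp only [add_apply, ContinuousLinearMap.comp_apply, ContinuousLinearMap.flip_apply, add_comm]

theorem lieDeriv_lieDeriv {f : E → F} {z : E} (A : E →L[ℝ] E) (hf : ContDiffAt ℝ 2 f z) :
    lieDeriv A (lieDeriv A f) z =
      fderiv ℝ (fderiv ℝ f) z (A z) (A z) + fderiv ℝ f z (A (A z)) :=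
  fderiv_lieDeriv A hf (A z)

theorem fderiv_fderiv_apply_self {f : E → ℂ} {z : E} {c : ℂ} (hf : ContDiffAt ℝ 2 f z)
    (h : lieDeriv (.id ℝ E) f =ᶠ[nhds z] fun w => c * f w) (v : E) :
    fderiv ℝ (fderiv ℝ f) z v z = (c - 1) * fderiv ℝ f z v := by
  have hv := fderiv_lieDeriv (.id ℝ E) hf v
  rw [h.fderiv_eq, fderiv_const_mul (hf.differentiableAt two_ne_zero)] at hv
  simp only [smul_apply, smul_eq_mul, ContinuousLinearMap.id_apply] at hv
  linear_combination -hv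

theorem lieDeriv_mul {f g : E → ℂ} {z : E} (A : E →L[ℝ] E) (hf : DifferentiableAt ℝ f z)
    (hg : DifferentiableAt ℝ g z) :
    lieDeriv A (fun w => f w * g w) z = f z * lieDeriv A g z + lieDeriv A f z * g z := by
  simp only [lieDeriv, fderiv_fun_mul hf hg, add_apply, smul_apply, smul_eq_mul, mul_comm]

theorem lieDeriv_comp_equiv {A : E →L[ℝ] E} (S : E ≃L[ℝ] E) (hS : ∀ z, S (A z) = A (S z))
    (f : E → F) (z : E) : lieDeriv A (fun w => f (S w)) z = lieDeriv A f (S z) := by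
  have h := S.comp_right_fderiv (f := f) (x := z)
  change fderiv ℝ (f ∘ S) z (A z) = _
  rw [h, ContinuousLinearMap.comp_apply, lieDeriv, ← hS]
  rfl

theorem lieDeriv_eq_of_curve {A : E →L[ℝ] E} {f g : E → F} {z : E} {γ : ℝ → E}
    (hγ : HasDerivAt γ (A z) 0) (hz : γ 0 = z) (hf : DifferentiableAt ℝ f z)
    (hg : DifferentiableAt ℝ g z) (h : ∀ t, f (γ t) = g (γ t)) :
    lieDeriv A f z = lieDeriv A g z := by
  subst hz
  have hfγ := hf.hasFDerivAt.comp_hasDerivAt 0 hγ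
  have hgγ := hg.hasFDerivAt.comp_hasDerivAt 0 hγ
  rw [show f ∘ γ = g ∘ γ from funext h] at hfγ
  exact hfγ.unique hgγ

end LinearVectorFields

section Rotations

variable {ι : Type*} [DecidableEq ι]

/-- The infinitesimal rotation `z_i ∂_j - z_j ∂_i` as a linear vector field. -/
def rotGen (i j : ι) : (ι → ℝ) →L[ℝ] (ι → ℝ) :=
  (ContinuousLinearMap.proj i).smulRight (Pi.single j 1) -
    (ContinuousLinearMap.proj j).smulRight (Pi.single i 1)

theorem rotGen_apply (i j : ι) (z : ι → ℝ) :
    rotGen i j z = z i • Pi.single j 1 - z j • Pi.single i 1 := rfl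

theorem rotGen_self (i : ι) : rotGen i i = 0 := sub_self _

theorem rotGen_rotGen {i j : ι} (hij : i ≠ j) (z : ι → ℝ) :
    rotGen i j (rotGen i j z) = -(z i • Pi.single i 1 + z j • Pi.single j 1) := by
  simp only [rotGen_apply, Pi.sub_apply, Pi.smul_apply, Pi.single_eq_same, Pi.single_eq_of_ne hij,
    Pi.single_eq_of_ne hij.symm, smul_eq_mul, mul_one, mul_zero, zero_sub, sub_zero, neg_smul]
  abel

/-- The rotation by the angle `t` in the coordinate plane of `i ≠ j`. -/
def rot (i j : ι) (t : ℝ) (z : ι → ℝ) : ι → ℝ :=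
  z + (Real.cos t - 1) • (z i • Pi.single i 1 + z j • Pi.single j 1) + Real.sin t • rotGen i j z

theorem rot_zero (i j : ι) (z : ι → ℝ) : rot i j 0 z = z := by
  simp only [rot, Real.cos_zero, sub_self, zero_smul, add_zero, Real.sin_zero]

theorem hasDerivAt_rot [Finite ι] (i j : ι) (z : ι → ℝ) :
    HasDerivAt (fun t => rot i j t z) (rotGen i j z) 0 := by
  cases nonempty_fintype ι
  have hcos := ((Real.hasDerivAt_cos 0).sub_const 1).smul_const
    (z i • Pi.single i 1 + z j • Pi.single j 1 : ι → ℝ)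
  have hsin := (Real.hasDerivAt_sin 0).smul_const (rotGen i j z)
  refine ((hcos.const_add z).add hsin).congr_deriv ?_
  simp only [Real.sin_zero, neg_zero, zero_smul, Real.cos_zero, one_smul, zero_add]

theorem rot_apply_of_ne {i j k : ι} (hi : k ≠ i) (hj : k ≠ j) (t : ℝ) (z : ι → ℝ) :
    rot i j t z k = z k := by
  simp [rot, rotGen_apply, hi, hj]

theorem rot_apply_left {i j : ι} (h : i ≠ j) (t : ℝ) (z : ι → ℝ) :
    rot i j t z i = Real.cos t * z i - Real.sin t * z j := by
  simp only [rot, rotGen_apply, Pi.add_apply, Pi.smul_apply, Pi.sub_apply, Pi.single_eq_same,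
    Pi.single_eq_of_ne h, smul_eq_mul]
  ring

theorem rot_apply_right {i j : ι} (h : i ≠ j) (t : ℝ) (z : ι → ℝ) :
    rot i j t z j = Real.cos t * z j + Real.sin t * z i := by
  simp only [rot, rotGen_apply, Pi.add_apply, Pi.smul_apply, Pi.sub_apply, Pi.single_eq_same,
    Pi.single_eq_of_ne h.symm, smul_eq_mul]
  ring

theorem sum_sq_rot {κ : Type*} [Fintype κ] {e : κ → ι} (he : Function.Injective e) {i j : κ}
    (hij : i ≠ j) (t : ℝ) (z : ι → ℝ) :
    ∑ k, rot (e i) (e j) t z (e k) ^ 2 = ∑ k, z (e k) ^ 2 := by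
  have hne : e i ≠ e j := he.ne hij
  rw [← sub_eq_zero, ← Finset.sum_sub_distrib, Fintype.sum_eq_add i j hij]
  · rw [rot_apply_left hne, rot_apply_right hne]
    linear_combination (z (e i) ^ 2 + z (e j) ^ 2) * Real.sin_sq_add_cos_sq t
  · rintro k ⟨hi, hj⟩
    rw [rot_apply_of_ne (he.ne hi) (he.ne hj), sub_self]

end Rotations

section Angular

variable {ι κ : Type*} [Fintype ι] [DecidableEq ι] [Fintype κ]

/-- The component of `z` in the coordinates `e i`. -/
def block (e : κ → ι) (z : ι → ℝ) : ι → ℝ := ∑ i, z (e i) • Pi.single (e i) 1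

/-- The sum over the pairs `{i, j}` of the squares of the infinitesimal rotations in the
coordinates `e i` and `e j`. On a sphere around `0` in the coordinates `e` it is the
Laplace-Beltrami operator of the unit sphere. Every pair occurs twice in the double sum, which
the factor `1 / 2` corrects. -/
def angular (e : κ → ι) (f : (ι → ℝ) → ℂ) (z : ι → ℝ) : ℂ :=
  (1 / 2 : ℂ) * ∑ i, ∑ j,
    lieDeriv (rotGen (e i) (e j)) (lieDeriv (rotGen (e i) (e j)) f) z

theorem angular_congr {f g : (ι → ℝ) → ℂ} {z : ι → ℝ} (e : κ → ι)
    (h : f =ᶠ[nhds z] g) : angular e f z = angular e g z := by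
  simp only [angular, (lieDeriv_congr _ (lieDeriv_congr _ h)).eq_of_nhds]

theorem contDiff_angular {f : (ι → ℝ) → ℂ} (e : κ → ι) (hf : ContDiff ℝ ∞ f) :
    ContDiff ℝ ∞ (angular e f) := by
  exact contDiff_const.mul <| ContDiff.sum fun _ _ => ContDiff.sum fun _ _ =>
    contDiff_lieDeriv _ (contDiff_lieDeriv _ hf)

theorem angular_comp_equiv {e : κ → ι} (S : (ι → ℝ) ≃L[ℝ] (ι → ℝ))
    (hS : ∀ i j z, S (rotGen (e i) (e j) z) = rotGen (e i) (e j) (S z)) (f : (ι → ℝ) → ℂ)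
    (z : ι → ℝ) : angular e (fun w => f (S w)) z = angular e f (S z) := by
  have hL (i j : κ) (g : (ι → ℝ) → ℂ) :
      lieDeriv (rotGen (e i) (e j)) (fun w => g (S w)) =
        fun w => lieDeriv (rotGen (e i) (e j)) g (S w) :=
    funext (lieDeriv_comp_equiv S (hS i j) g)
  simp only [angular, hL]

theorem lieDeriv_rotGen_eqOn {s : Set (ι → ℝ)} {i j : ι}
    (hs : i ≠ j → ∀ t, ∀ z ∈ s, rot i j t z ∈ s) {f g : (ι → ℝ) → ℂ}
    (hf : ∀ z ∈ s, DifferentiableAt ℝ f z) (hg : ∀ z ∈ s, DifferentiableAt ℝ g z)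
    (h : Set.EqOn f g s) : Set.EqOn (lieDeriv (rotGen i j) f) (lieDeriv (rotGen i j) g) s := by
  intro z hz
  by_cases hij : i = j
  · subst hij
    rw [rotGen_self, lieDeriv_zero, lieDeriv_zero]
  · exact lieDeriv_eq_of_curve (hasDerivAt_rot i j z) (rot_zero i j z) (hf z hz) (hg z hz)
      fun t => h (hs hij t z hz)

theorem angular_eqOn {s : Set (ι → ℝ)} {e : κ → ι}
    (hs : ∀ i j, e i ≠ e j → ∀ t, ∀ z ∈ s, rot (e i) (e j) t z ∈ s) {f g : (ι → ℝ) → ℂ}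
    (hf : ∀ z ∈ s, ContDiffAt ℝ 2 f z) (hg : ∀ z ∈ s, ContDiffAt ℝ 2 g z)
    (h : Set.EqOn f g s) : Set.EqOn (angular e f) (angular e g) s := by
  intro z hz
  have hL (i j : κ) : Set.EqOn (lieDeriv (rotGen (e i) (e j)) f)
      (lieDeriv (rotGen (e i) (e j)) g) s :=
    lieDeriv_rotGen_eqOn (hs i j) (fun w hw => (hf w hw).differentiableAt two_ne_zero)
      (fun w hw => (hg w hw).differentiableAt two_ne_zero) h
  have hLL (i j : κ) := lieDeriv_rotGen_eqOn (hs i j)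
    (fun w hw => differentiableAt_lieDeriv _ (hf w hw))
    (fun w hw => differentiableAt_lieDeriv _ (hg w hw)) (hL i j) hz
  simp only [angular, hLL]

theorem lieDeriv_rotGen_sq {i j : ι} {f : (ι → ℝ) → ℂ} {z : ι → ℝ} (hf : ContDiffAt ℝ 2 f z) :
    lieDeriv (rotGen i j) (lieDeriv (rotGen i j) f) z =
      (z i : ℂ) ^ 2 * fderiv ℝ (fderiv ℝ f) z (Pi.single j 1) (Pi.single j 1) +
        (z j : ℂ) ^ 2 * fderiv ℝ (fderiv ℝ f) z (Pi.single i 1) (Pi.single i 1) -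
        2 * (z i * (z j * fderiv ℝ (fderiv ℝ f) z (Pi.single i 1) (Pi.single j 1))) -
        (z i * fderiv ℝ f z (Pi.single i 1) + z j * fderiv ℝ f z (Pi.single j 1)) +
        if i = j then 2 * (z i * fderiv ℝ f z (Pi.single i 1)) else 0 := by
  split_ifs with hij
  · subst hij
    rw [rotGen_self, lieDeriv_zero]
    ring
  have hsymm : fderiv ℝ (fderiv ℝ f) z (Pi.single j 1) (Pi.single i 1) =
      fderiv ℝ (fderiv ℝ f) z (Pi.single i 1) (Pi.single j 1) :=
    hf.isSymmSndFDerivAt (by simp) _ _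
  rw [lieDeriv_lieDeriv _ hf, rotGen_rotGen hij]
  simp only [rotGen_apply, map_sub, map_smul, map_add, map_neg, sub_apply, smul_apply,
    Complex.real_smul, hsymm]
  ring

theorem angular_eq {f : (ι → ℝ) → ℂ} {z : ι → ℝ} (hf : ContDiffAt ℝ 2 f z) {e : κ → ι}
    (he : Function.Injective e) :
    angular e f z =
      ((∑ i, z (e i) ^ 2 : ℝ) : ℂ) *
          ∑ i, fderiv ℝ (fderiv ℝ f) z (Pi.single (e i) 1) (Pi.single (e i) 1) -
        fderiv ℝ (fderiv ℝ f) z (block e z) (block e z) -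
        ((Fintype.card κ : ℂ) - 1) * fderiv ℝ f z (block e z) := by
  classical
  have hD : fderiv ℝ f z (block e z) = ∑ i, z (e i) * fderiv ℝ f z (Pi.single (e i) 1) := by
    simp only [block, map_sum, map_smul, Complex.real_smul]
  have hH : fderiv ℝ (fderiv ℝ f) z (block e z) (block e z) =
      ∑ i, z (e i) * ∑ j, z (e j) *
        fderiv ℝ (fderiv ℝ f) z (Pi.single (e i) 1) (Pi.single (e j) 1) := by
    simp only [block, map_sum, map_smul, sum_apply, smul_apply, Complex.real_smul, Finset.mul_sum]
    rw [Finset.sum_comm]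
    simp only [mul_left_comm]
  have hL : ∑ i, ∑ j, (z (e j) : ℂ) ^ 2 *
        fderiv ℝ (fderiv ℝ f) z (Pi.single (e i) 1) (Pi.single (e i) 1) =
      ((∑ i, z (e i) ^ 2 : ℝ) : ℂ) *
        ∑ i, fderiv ℝ (fderiv ℝ f) z (Pi.single (e i) 1) (Pi.single (e i) 1) := by
    push_cast
    rw [Finset.sum_mul_sum, Finset.sum_comm]
  have hL' := hL
  rw [Finset.sum_comm] at hL'
  simp only [angular, lieDeriv_rotGen_sq hf, he.eq_iff, Finset.sum_add_distrib,
    Finset.sum_sub_distrib, Finset.sum_ite_eq, Finset.mem_univ, if_true, hL, hL',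
    Finset.sum_const, Finset.card_univ, nsmul_eq_mul]
  simp only [← Finset.mul_sum, ← hH, ← hD]
  ring

end Angular

section LaplaceBeltrami

variable {p q : ℕ}

theorem normX_eq_of_inl {v w : Space p q} (h : ∀ i, v (Sum.inl i) = w (Sum.inl i)) :
    normX v = normX w := by simp only [normX, h]

theorem normY_eq_of_inr {v w : Space p q} (h : ∀ j, v (Sum.inr j) = w (Sum.inr j)) :
    normY v = normY w := by simp only [normY, h]

theorem normX_rot_inl {i j : Fin p} (hij : i ≠ j) (t : ℝ) (z : Space p q) :
    normX (rot (Sum.inl i) (Sum.inl j) t z) = normX z := by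
  rw [normX, sum_sq_rot Sum.inl_injective hij, normX]

theorem normY_rot_inl (i j : Fin p) (t : ℝ) (z : Space p q) :
    normY (rot (Sum.inl i) (Sum.inl j) t z) = normY z :=
  normY_eq_of_inr fun _ => rot_apply_of_ne Sum.inr_ne_inl Sum.inr_ne_inl t z

theorem normX_rot_inr (i j : Fin q) (t : ℝ) (z : Space p q) :
    normX (rot (Sum.inr i) (Sum.inr j) t z) = normX z :=
  normX_eq_of_inl fun _ => rot_apply_of_ne Sum.inl_ne_inr Sum.inl_ne_inr t z

theorem normY_rot_inr {i j : Fin q} (hij : i ≠ j) (t : ℝ) (z : Space p q) :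
    normY (rot (Sum.inr i) (Sum.inr j) t z) = normY z := by
  rw [normY, sum_sq_rot Sum.inr_injective hij, normY]

theorem block_inl (z : Space p q) :
    block Sum.inl z = Sum.elim (fun i => z (Sum.inl i)) (fun _ => 0) := by
  funext k
  cases k <;> simp [block, Pi.single_apply]

theorem block_inr (z : Space p q) :
    block Sum.inr z = Sum.elim (fun _ => 0) (fun j => z (Sum.inr j)) := by
  funext k
  cases k <;> simp [block, Pi.single_apply]

theorem block_inl_add_block_inr (z : Space p q) : block Sum.inl z + block Sum.inr z = z := by
  rw [block_inl, block_inr]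
  funext k
  cases k <;> simp

theorem radial_of_mem {v : Space p q} (hv : v ∈ spheres p q) : radial v = v :=
  congrArg Subtype.val (proj_toCone ⟨v, hv⟩)

theorem extend_of_mem (f : spheres p q → ℂ) (z : spheres p q) : extend f z = f z := by
  have h : radial (z : Space p q) = z := radial_of_mem z.2
  rw [extend, dif_pos (by rw [h]; exact z.2)]
  exact congrArg f (Subtype.ext h)

theorem extend_congr (f : spheres p q → ℂ) {v w : Space p q} (h : radial v = radial w) :
    extend f v = extend f w := by
  unfold extend
  congr! 2
  exact Subtype.ext h

theorem sum_sq_inl (z : spheres p q) : ∑ i, (z : Space p q) (Sum.inl i) ^ 2 = 1 :=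
  Real.sqrt_eq_one.1 z.2.1

theorem sum_sq_inr (z : spheres p q) : ∑ j, (z : Space p q) (Sum.inr j) ^ 2 = 1 :=
  Real.sqrt_eq_one.1 z.2.2

theorem radial_eq_of_scale {v w : Space p q} {s t : ℝ} (hs : 0 < s) (ht : 0 < t)
    (hX : ∀ i, v (Sum.inl i) = s * w (Sum.inl i)) (hY : ∀ j, v (Sum.inr j) = t * w (Sum.inr j)) :
    radial v = radial w := by
  have hnX : normX v = s * normX w := by rw [← normX_smul hs.le]; exact normX_eq_of_inl hX
  have hnY : normY v = t * normY w := by rw [← normY_smul ht.le]; exact normY_eq_of_inr hY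
  funext k
  cases k with
  | inl i => simp only [radial, Sum.elim_inl, hnX, hX, mul_div_mul_left _ _ hs.ne']
  | inr j => simp only [radial, Sum.elim_inr, hnY, hY, mul_div_mul_left _ _ ht.ne']

theorem eventually_one_add_pos : ∀ᶠ t : ℝ in nhds 0, 0 < 1 + t := by
  have h : Continuous fun t : ℝ => 1 + t := by fun_prop
  exact h.continuousAt.eventually_const_lt (by norm_num)

theorem extend_add_smul_block_inl (f : spheres p q → ℂ) (z : Space p q) :
    ∀ᶠ t : ℝ in nhds 0, extend f (z + t • block Sum.inl z) = extend f z := by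
  filter_upwards [eventually_one_add_pos] with t ht
  refine extend_congr f (radial_eq_of_scale ht one_pos (fun i => ?_) (fun j => ?_))
  · rw [block_inl, Pi.add_apply, Pi.smul_apply, Sum.elim_inl, smul_eq_mul, one_add_mul]
  · rw [block_inl, Pi.add_apply, Pi.smul_apply, Sum.elim_inr, smul_zero, add_zero, one_mul]

theorem extend_add_smul_block_inr (f : spheres p q → ℂ) (z : Space p q) :
    ∀ᶠ t : ℝ in nhds 0, extend f (z + t • block Sum.inr z) = extend f z := by
  filter_upwards [eventually_one_add_pos] with t ht
  refine extend_congr f (radial_eq_of_scale one_pos ht (fun i => ?_) (fun j => ?_))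
  · rw [block_inr, Pi.add_apply, Pi.smul_apply, Sum.elim_inl, smul_zero, add_zero, one_mul]
  · rw [block_inr, Pi.add_apply, Pi.smul_apply, Sum.elim_inr, smul_eq_mul, one_add_mul]

theorem contDiffAt_two_extend {f : spheres p q → ℂ} (hf : f ∈ SmoothM p q) (z : spheres p q) :
    ContDiffAt ℝ 2 (extend f) (z : Space p q) :=
  (contDiffAt_extend hf z).of_le (WithTop.coe_le_coe.2 le_top)

theorem lapX_eq_angular {f : spheres p q → ℂ} (hf : f ∈ SmoothM p q) (z : spheres p q) :
    lapX f z = angular Sum.inl (extend f) z := by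
  have h2 := contDiffAt_two_extend hf z
  have hconst := extend_add_smul_block_inl f z
  rw [angular_eq h2 Sum.inl_injective, sum_sq_inl,
    fderiv_eq_zero_of_eventually_const (h2.differentiableAt two_ne_zero) hconst,
    fderiv_fderiv_eq_zero_of_eventually_const h2 hconst]
  simp [lapX, partial2, iteratedDeriv_two_line h2]

theorem lapY_eq_angular {f : spheres p q → ℂ} (hf : f ∈ SmoothM p q) (z : spheres p q) :
    lapY f z = angular Sum.inr (extend f) z := by
  have h2 := contDiffAt_two_extend hf z
  have hconst := extend_add_smul_block_inr f z
  rw [angular_eq h2 Sum.inr_injective, sum_sq_inr,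
    fderiv_eq_zero_of_eventually_const (h2.differentiableAt two_ne_zero) hconst,
    fderiv_fderiv_eq_zero_of_eventually_const h2 hconst]
  simp [lapY, partial2, iteratedDeriv_two_line h2]

theorem angular_inl_eq_lapX {f : spheres p q → ℂ} (hf : f ∈ SmoothM p q) {F : Space p q → ℂ}
    (hF : ∀ z : spheres p q, ContDiffAt ℝ 2 F (z : Space p q)) (hFf : ∀ z : spheres p q, F z = f z)
    (z : spheres p q) : angular Sum.inl F z = lapX f z := by
  rw [lapX_eq_angular hf]
  refine angular_eqOn (s := spheres p q) (fun i j hij t w hw => ?_) (fun w hw => hF ⟨w, hw⟩)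
    (fun w hw => contDiffAt_two_extend hf ⟨w, hw⟩)
    (fun w hw => (hFf ⟨w, hw⟩).trans (extend_of_mem f ⟨w, hw⟩).symm) z.2
  exact ⟨(normX_rot_inl (ne_of_apply_ne _ hij) t w).trans hw.1,
    (normY_rot_inl i j t w).trans hw.2⟩

theorem angular_inr_eq_lapY {f : spheres p q → ℂ} (hf : f ∈ SmoothM p q) {F : Space p q → ℂ}
    (hF : ∀ z : spheres p q, ContDiffAt ℝ 2 F (z : Space p q)) (hFf : ∀ z : spheres p q, F z = f z)
    (z : spheres p q) : angular Sum.inr F z = lapY f z := by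
  rw [lapY_eq_angular hf]
  refine angular_eqOn (s := spheres p q) (fun i j hij t w hw => ?_) (fun w hw => hF ⟨w, hw⟩)
    (fun w hw => contDiffAt_two_extend hf ⟨w, hw⟩)
    (fun w hw => (hFf ⟨w, hw⟩).trans (extend_of_mem f ⟨w, hw⟩).symm) z.2
  exact ⟨(normX_rot_inr i j t w).trans hw.1,
    (normY_rot_inr (ne_of_apply_ne _ hij) t w).trans hw.2⟩

end LaplaceBeltrami

section Ultrahyperbolic

variable {p q : ℕ}

/-- The ultrahyperbolic operator `∑ ∂²/∂x_i² - ∑ ∂²/∂y_j²`. -/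
def box (F : Space p q → ℂ) (z : Space p q) : ℂ :=
  ∑ i : Fin p, fderiv ℝ (fderiv ℝ F) z (Pi.single (Sum.inl i) 1) (Pi.single (Sum.inl i) 1) -
    ∑ j : Fin q, fderiv ℝ (fderiv ℝ F) z (Pi.single (Sum.inr j) 1) (Pi.single (Sum.inr j) 1)

variable (p q) in
/-- The zeroth order term `(p + q - 4) (p - q) / 4` of the Yamabe operator, after cancelling the
factor `p + q - 3` of the scalar curvature. -/
def yamabeConst : ℂ := ((p : ℂ) + q - 4) * ((p : ℂ) - q) / 4

theorem yamabe_apply (h : p + q ≠ 3) (f : spheres p q → ℂ) (z : spheres p q) :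
    yamabe f z = lapX f z - lapY f z - yamabeConst p q * f z := by
  have h3 : (p : ℂ) + q - 3 ≠ 0 := by
    rw [sub_ne_zero]
    exact_mod_cast h
  rw [yamabe, yamabeConst]
  field_simp
  ring

theorem box_eq_yamabe (hpq : p + q ≠ 3) {f : spheres p q → ℂ} (hf : f ∈ SmoothM p q)
    {F : Space p q → ℂ} (hF : ∀ z : spheres p q, ContDiffAt ℝ 2 F (z : Space p q))
    (hFf : ∀ z : spheres p q, F z = f z) (z : spheres p q)
    (hE : lieDeriv (.id ℝ (Space p q)) F =ᶠ[nhds (z : Space p q)]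
      fun v => -(((p : ℂ) + q - 4) / 2) * F v) : box F z = yamabe f z := by
  have hX := angular_inl_eq_lapX hf hF hFf z
  have hY := angular_inr_eq_lapY hf hF hFf z
  rw [angular_eq (hF z) Sum.inl_injective, sum_sq_inl] at hX
  rw [angular_eq (hF z) Sum.inr_injective, sum_sq_inr] at hY
  have hEx := fderiv_fderiv_apply_self (hF z) hE (block Sum.inl z)
  have hEy := fderiv_fderiv_apply_self (hF z) hE (block Sum.inr z)
  have hEz : fderiv ℝ F z z = _ := hE.self_of_nhds
  have hsymm : fderiv ℝ (fderiv ℝ F) z (block Sum.inl z) (block Sum.inr z) = _ :=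
    (hF z).isSymmSndFDerivAt (by simp) _ _
  have hz (D : Space p q →L[ℝ] ℂ) : D z = D (block Sum.inl z) + D (block Sum.inr z) := by
    rw [← map_add, block_inl_add_block_inr]
  rw [hz] at hEx hEy hEz
  rw [yamabe_apply hpq, ← hX, ← hY, ← hFf z, box, yamabeConst]
  simp only [Fintype.card_fin]
  push_cast
  linear_combination hEx - hEy - hsymm + ((p : ℂ) - q) / 2 * hEz

end Ultrahyperbolic

section ConformalInvariance

theorem sum_smul_mulVec_mulVec {ι : Type*} [Fintype ι] [DecidableEq ι]
    (H : (ι → ℝ) →L[ℝ] (ι → ℝ) →L[ℝ] ℂ) (A S : Matrix ι ι ℝ) :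
    ∑ k, ∑ l, S k l • H (A *ᵥ Pi.single k 1) (A *ᵥ Pi.single l 1) =
      ∑ i, ∑ j, (A * S * Aᵀ) i j • H (Pi.single i 1) (Pi.single j 1) := by
  have hcol (k : ι) : A *ᵥ Pi.single k 1 = ∑ i, A i k • (Pi.single i 1 : ι → ℝ) := by
    rw [Matrix.mulVec_single_one, ← Finset.univ_sum_single (A.col k)]
    simp only [← Pi.single_smul, smul_eq_mul, mul_one, Matrix.col_apply]
  have hentry (i j : ι) : (A * S * Aᵀ) i j = ∑ k, ∑ l, A i k * S k l * A j l := by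
    simp only [Matrix.mul_apply, Matrix.transpose_apply, Finset.sum_mul]
    rw [Finset.sum_comm]
  simp only [hcol, hentry, map_sum, map_smul, sum_apply, smul_apply, Finset.smul_sum,
    Finset.sum_smul, smul_smul]
  rw [Finset.sum_comm_cycle, Finset.sum_congr rfl fun i _ => Finset.sum_comm_cycle,
    Finset.sum_comm]
  refine Finset.sum_congr rfl fun i _ => Finset.sum_congr rfl fun j _ =>
    Finset.sum_congr rfl fun k _ => Finset.sum_congr rfl fun l _ => ?_
  congr 1
  ring

variable {p q : ℕ}

theorem box_eq_sum_Ipq (F : Space p q → ℂ) (z : Space p q) :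
    box F z = ∑ i, ∑ j, Ipq p q i j •
      fderiv ℝ (fderiv ℝ F) z (Pi.single i 1) (Pi.single j 1) := by
  simp [box, Ipq, LieAlgebra.Orthogonal.indefiniteDiagonal, Matrix.diagonal_apply, ite_smul,
    sub_eq_add_neg]

theorem box_comp_mulVec {A : Mat p q} {c : ℝ} (hA : A * Ipq p q * Aᵀ = c • Ipq p q)
    {F : Space p q → ℂ} {z : Space p q} (hF : ContDiffAt ℝ 2 F (A *ᵥ z)) :
    box (fun v => F (A *ᵥ v)) z = c * box F (A *ᵥ z) := by
  have hH := fderiv_fderiv_comp_clm A.mulVecLin.toContinuousLinearMap hF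
  simp only [LinearMap.coe_toContinuousLinearMap', Matrix.mulVecLin_apply] at hH
  simp only [box_eq_sum_Ipq, hH]
  rw [sum_smul_mulVec_mulVec, hA]
  simp only [Matrix.smul_apply, smul_assoc, Complex.real_smul, Finset.mul_sum]

theorem box_const_mul (c : ℂ) {F : Space p q → ℂ} {z : Space p q} (hF : ContDiffAt ℝ 2 F z) :
    box (fun v => c * F v) z = c * box F z := by
  have hfderiv : fderiv ℝ (fun v => c * F v) =ᶠ[nhds z] fun v => c • fderiv ℝ F v := by
    filter_upwards [hF.eventually (by simp)] with v hv
    exact fderiv_const_mul (hv.differentiableAt two_ne_zero) c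
  have hdF : DifferentiableAt ℝ (fderiv ℝ F) z :=
    (hF.fderiv_right (m := 1) one_add_one_eq_two.le).differentiableAt one_ne_zero
  simp only [box, hfderiv.fderiv_eq, fderiv_fun_const_smul hdF, smul_apply, smul_eq_mul,
    ← Finset.mul_sum, mul_sub]

theorem Ipq_mul_self : Ipq p q * Ipq p q = 1 := by
  rw [Ipq, LieAlgebra.Orthogonal.indefiniteDiagonal, Matrix.diagonal_mul_diagonal,
    ← Matrix.diagonal_one]
  congr 1
  funext k
  cases k <;> simp

theorem mat_mul_Ipq_mul_transpose (g : G p q) : mat g * Ipq p q * (mat g)ᵀ = Ipq p q := by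
  have hform : (mat g)ᵀ * Ipq p q * mat g = Ipq p q := g.2
  have hleft : (Ipq p q * (mat g)ᵀ * Ipq p q) * mat g = 1 := by
    rw [mul_assoc, mul_assoc, ← mul_assoc (mat g)ᵀ, hform, Ipq_mul_self]
  have hright := mul_eq_one_comm.1 hleft
  calc mat g * Ipq p q * (mat g)ᵀ
      = mat g * (Ipq p q * (mat g)ᵀ * Ipq p q) * Ipq p q := by
        simp only [mul_assoc, Ipq_mul_self, mul_one]
    _ = _ := by rw [hright, one_mul]

theorem lieDeriv_id_of_homogeneous {E : Type*} [NormedAddCommGroup E] [NormedSpace ℝ E]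
    {F : E → ℂ} {a : ℂ} {v : E} (hF : DifferentiableAt ℝ F v)
    (h : ∀ t : ℝ, 0 < t → F (t • v) = (t : ℂ) ^ a * F v) :
    lieDeriv (.id ℝ E) F v = a * F v := by
  have hray : HasDerivAt (fun t : ℝ => t • v) v 1 := by
    simpa using (hasDerivAt_id (1 : ℝ)).smul_const v
  have hF1 : HasFDerivAt F (fderiv ℝ F v) ((1 : ℝ) • v) := by simpa using hF.hasFDerivAt
  have hpow : HasDerivAt (fun t : ℂ => t ^ a) a ((1 : ℝ) : ℂ) := by
    simpa using (hasDerivAt_id (1 : ℂ)).cpow_const (c := a) (by simp)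
  refine (hF1.comp_hasDerivAt (1 : ℝ) hray).unique
    ((hpow.comp_ofReal.mul_const (F v)).congr_of_eventuallyEq ?_)
  filter_upwards [lt_mem_nhds one_pos] with t ht using h t ht

theorem contDiffAt_extend_of_pos {f : spheres p q → ℂ} (hf : f ∈ SmoothM p q) {v : Space p q}
    (hx : 0 < normX v) (hy : 0 < normY v) : ContDiffAt ℝ ∞ (extend f) v := by
  refine (ContDiffAt.comp v (contDiffAt_extend hf ⟨radial v, radial_mem hx hy⟩)
    (contDiffAt_radial hx hy)).congr_of_eventuallyEq ?_
  filter_upwards [continuous_normX.continuousAt.eventually_const_lt hx,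
    continuous_normY.continuousAt.eventually_const_lt hy] with w hwx hwy
  exact extend_congr f (radial_of_mem (radial_mem hwx hwy)).symm

/-- The extension of a function on `M` to a homogeneous function of degree `a`. -/
def homExt (a : ℂ) (f : spheres p q → ℂ) (v : Space p q) : ℂ :=
  (normX v : ℂ) ^ a * extend f v

theorem contDiffAt_normX_cpow (a : ℂ) {v : Space p q} (hx : 0 < normX v) :
    ContDiffAt ℝ ∞ (fun v : Space p q => (normX v : ℂ) ^ a) v := by
  have hlog : ContDiffAt ℝ ∞ (fun v : Space p q => Real.log (normX v)) v :=
    (contDiffOn_normX.contDiffAt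
      ((isOpen_lt continuous_const continuous_normX).mem_nhds hx)).log hx.ne'
  have hexp : ContDiffAt ℝ ∞ (fun v : Space p q => Complex.exp (Real.log (normX v) * a)) v :=
    ((Complex.ofRealCLM.contDiff.contDiffAt.comp v hlog).mul contDiffAt_const).cexp
  refine hexp.congr_of_eventuallyEq ?_
  filter_upwards [continuous_normX.continuousAt.eventually_const_lt hx] with w hw
  rw [Complex.cpow_def_of_ne_zero (by exact_mod_cast hw.ne'), ← Complex.ofReal_log hw.le]

theorem contDiffAt_homExt (a : ℂ) {f : spheres p q → ℂ} (hf : f ∈ SmoothM p q) {v : Space p q}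
    (hx : 0 < normX v) (hy : 0 < normY v) : ContDiffAt ℝ ∞ (homExt a f) v :=
  (contDiffAt_normX_cpow a hx).mul (contDiffAt_extend_of_pos hf hx hy)

theorem contDiffAt_homExt_cone (a : ℂ) {f : spheres p q → ℂ} (hf : f ∈ SmoothM p q)
    (ξ : cone p q) : ContDiffAt ℝ ∞ (homExt a f) (ξ : Space p q) :=
  contDiffAt_homExt a hf (normX_pos ξ) (ξ.2.1 ▸ normX_pos ξ)

theorem homExt_smul (a : ℂ) (f : spheres p q → ℂ) {t : ℝ} (ht : 0 < t) (v : Space p q) :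
    homExt a f (t • v) = (t : ℂ) ^ a * homExt a f v := by
  rw [homExt, homExt, normX_smul ht.le, Complex.ofReal_mul,
    Complex.mul_cpow_ofReal_nonneg ht.le (normX_nonneg _),
    extend_congr f (radial_eq_of_scale ht ht (w := v) (fun _ => rfl) fun _ => rfl), mul_assoc]

theorem homExt_cone (a : ℂ) (f : spheres p q → ℂ) (ξ : cone p q) :
    homExt a f ξ = (nu (ξ : Space p q) : ℂ) ^ a * f (proj ξ) := by
  rw [homExt, extend, dif_pos (show radial (ξ : Space p q) ∈ spheres p q from (proj ξ).2)]
  rfl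

theorem homExt_of_mem (a : ℂ) (f : spheres p q → ℂ) (z : spheres p q) : homExt a f z = f z := by
  rw [homExt, extend_of_mem, z.2.1, Complex.ofReal_one, Complex.one_cpow, one_mul]

theorem homExt_mat_inv_mulVec (lam : ℂ) (h : G p q) (f : SmoothM p q) (z : spheres p q) :
    homExt (-lam) f (mat h⁻¹ *ᵥ (z : Space p q)) = (varpi p q lam h f : spheres p q → ℂ) z :=
  homExt_cone (-lam) (f : spheres p q → ℂ) (h⁻¹ • toCone z)

variable (p q) in
/-- The degree of homogeneity `-(p+q-4)/2` for which the Yamabe operator of `M` becomes the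
ultrahyperbolic operator. -/
def confDegree : ℂ := -(((p : ℂ) + q - 4) / 2)

theorem box_homExt_of_mem_V (hpq : p + q ≠ 3) {f : SmoothM p q} (hf : f ∈ V p q)
    (z : spheres p q) : box (homExt (confDegree p q) f) (z : Space p q) = 0 := by
  have hF (v : Space p q) (hx : 0 < normX v) (hy : 0 < normY v) :
      ContDiffAt ℝ 2 (homExt (confDegree p q) f) v :=
    (contDiffAt_homExt _ f.2 hx hy).of_le (WithTop.coe_le_coe.2 le_top)
  rw [box_eq_yamabe hpq f.2 (fun w => hF w (normX_pos_of_mem w) (normY_pos_of_mem w))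
    (homExt_of_mem _ _), hf z]
  filter_upwards [continuous_normX.continuousAt.eventually_const_lt (normX_pos_of_mem z),
    continuous_normY.continuousAt.eventually_const_lt (normY_pos_of_mem z)] with v hx hy
  exact lieDeriv_id_of_homogeneous ((hF v hx hy).differentiableAt two_ne_zero)
    fun t ht => homExt_smul _ _ ht v

theorem box_homExt_cone_of_mem_V (hpq : p + q ≠ 3) {f : SmoothM p q} (hf : f ∈ V p q)
    (ξ : cone p q) : box (homExt (confDegree p q) f) (ξ : Space p q) = 0 := by
  set F := homExt (confDegree p q) (f : spheres p q → ℂ)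
  have hF (η : cone p q) : ContDiffAt ℝ 2 F (η : Space p q) :=
    (contDiffAt_homExt_cone _ f.2 η).of_le (WithTop.coe_le_coe.2 le_top)
  have ht := normX_pos ξ
  set t := normX (ξ : Space p q)
  have hξ : (t • (1 : Mat p q)) *ᵥ (proj ξ : Space p q) = ξ := by
    rw [Matrix.smul_mulVec, Matrix.one_mulVec, ← smul_inv_smul₀ ht.ne' (ξ : Space p q)]
    exact congrArg _ (radial_eq ξ)
  have hFsmul : (fun v => F ((t • (1 : Mat p q)) *ᵥ v)) =
      fun v => (t : ℂ) ^ confDegree p q * F v := by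
    funext v
    rw [Matrix.smul_mulVec, Matrix.one_mulVec]
    exact homExt_smul _ _ ht v
  have hscale := box_comp_mulVec (c := t ^ 2) (A := t • (1 : Mat p q)) (F := F)
    (z := (proj ξ : Space p q))
    (by simp [smul_smul, pow_two]) (hξ ▸ hF ξ)
  have hFproj : ContDiffAt ℝ 2 F (proj ξ : Space p q) := hF (toCone (proj ξ))
  rw [hFsmul, box_const_mul _ hFproj, box_homExt_of_mem_V hpq hf, mul_zero, hξ] at hscale
  exact (mul_eq_zero.1 hscale.symm).resolve_left (by exact_mod_cast (pow_pos ht 2).ne')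

theorem varpi_mem_V (hpq : p + q ≠ 3) (h : G p q) {f : SmoothM p q} (hf : f ∈ V p q) :
    varpi p q (((p : ℂ) + q - 4) / 2) h f ∈ V p q := by
  intro z
  set F := homExt (confDegree p q) (f : spheres p q → ℂ)
  have hF (w : spheres p q) : ContDiffAt ℝ 2 F (mat h⁻¹ *ᵥ (w : Space p q)) :=
    (contDiffAt_homExt_cone _ f.2 (h⁻¹ • toCone w)).of_le (WithTop.coe_le_coe.2 le_top)
  have hFh (w : spheres p q) : ContDiffAt ℝ 2 (fun v => F (mat h⁻¹ *ᵥ v)) w :=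
    (hF w).comp (w : Space p q)
      ((contDiff_mulVec _).of_le (WithTop.coe_le_coe.2 le_top)).contDiffAt
  have hinv := box_comp_mulVec (c := 1) (A := mat h⁻¹) (z := (z : Space p q))
    (by rw [mat_mul_Ipq_mul_transpose, one_smul]) (hF z)
  have hzero : box F (mat h⁻¹ *ᵥ (z : Space p q)) = 0 :=
    box_homExt_cone_of_mem_V hpq hf (h⁻¹ • toCone z)
  rw [hzero, mul_zero] at hinv
  refine (box_eq_yamabe hpq (varpi p q _ h f).2 hFh (homExt_mat_inv_mulVec _ h f) z ?_).symm.trans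
    hinv
  filter_upwards [(hFh z).eventually (by simp)] with v hv
  refine lieDeriv_id_of_homogeneous (hv.differentiableAt two_ne_zero) fun t ht => ?_
  rw [Matrix.mulVec_smul]
  exact homExt_smul _ _ ht _

end ConformalInvariance

section AngularSymmetry

open MeasureTheory

variable {ι : Type*} [Fintype ι]

theorem integrable_mul_of_hasCompactSupport {f g : (ι → ℝ) → ℂ} (hf : Continuous f)
    (hc : HasCompactSupport f) (hg : Continuous g) : Integrable fun z => f z * g z :=
  (hf.mul hg).integrable_of_hasCompactSupport hc.mul_right

theorem hasCompactSupport_lieDeriv {f : (ι → ℝ) → ℂ} (A : (ι → ℝ) →L[ℝ] (ι → ℝ))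
    (hc : HasCompactSupport f) : HasCompactSupport (lieDeriv A f) :=
  (hc.fderiv ℝ).mono fun z hz h => hz (by rw [lieDeriv, h, zero_apply])

theorem integral_clm_mul_fderiv_eq_zero {h : (ι → ℝ) → ℂ} (hh : ContDiff ℝ ∞ h)
    (hc : HasCompactSupport h) (l : (ι → ℝ) →L[ℝ] ℂ) {v : ι → ℝ} (hv : l v = 0) :
    ∫ z, l z * fderiv ℝ h z v = 0 := by
  have hdh : Continuous fun z => fderiv ℝ h z v :=
    ((hh.fderiv_right (m := ∞) le_rfl).clm_apply contDiff_const).continuous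
  have hdl (z : ι → ℝ) : fderiv ℝ l z v = 0 := by rw [l.fderiv, hv]
  rw [integral_mul_fderiv_eq_neg_fderiv_mul_of_integrable]
  · simp only [hdl, zero_mul, integral_zero, neg_zero]
  · simp only [hdl, zero_mul]
    exact integrable_zero _ _ _
  · simpa only [mul_comm] using
      integrable_mul_of_hasCompactSupport hdh (hc.fderiv_apply ℝ v) l.continuous
  · simpa only [mul_comm] using integrable_mul_of_hasCompactSupport hh.continuous hc l.continuous
  · exact fun z _ => l.differentiableAt
  · exact fun z _ => (hh.differentiable (by simp)) z

variable [DecidableEq ι]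

theorem integral_lieDeriv_rotGen {h : (ι → ℝ) → ℂ} (hh : ContDiff ℝ ∞ h)
    (hc : HasCompactSupport h) (i j : ι) : ∫ z, lieDeriv (rotGen i j) h z = 0 := by
  by_cases hij : i = j
  · simp only [hij, rotGen_self, lieDeriv_zero, integral_zero]
  let coord (k : ι) : (ι → ℝ) →L[ℝ] ℂ := Complex.ofRealCLM.comp (ContinuousLinearMap.proj k)
  have hint (k l : ι) : Integrable fun z => coord k z * fderiv ℝ h z (Pi.single l 1) := by
    simpa only [mul_comm] using integrable_mul_of_hasCompactSupport
      ((hh.fderiv_right (m := ∞) le_rfl).clm_apply contDiff_const).continuous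
      (hc.fderiv_apply ℝ (Pi.single l 1)) (coord k).continuous
  calc ∫ z, lieDeriv (rotGen i j) h z
      = ∫ z, (coord i z * fderiv ℝ h z (Pi.single j 1) -
          coord j z * fderiv ℝ h z (Pi.single i 1)) := by
        simp [lieDeriv, rotGen_apply, coord]
    _ = 0 := by
        rw [integral_sub (hint i j) (hint j i),
          integral_clm_mul_fderiv_eq_zero hh hc _ (by simp [coord, hij]),
          integral_clm_mul_fderiv_eq_zero hh hc _ (by simp [coord, Ne.symm hij]), sub_zero]

theorem integral_lieDeriv_rotGen_mul {f g : (ι → ℝ) → ℂ} (hf : ContDiff ℝ ∞ f)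
    (hc : HasCompactSupport f) (hg : ContDiff ℝ ∞ g) (i j : ι) :
    ∫ z, lieDeriv (rotGen i j) f z * g z = -∫ z, f z * lieDeriv (rotGen i j) g z := by
  have hprod := integral_lieDeriv_rotGen (hf.mul hg) hc.mul_right i j
  have hleibniz (z : ι → ℝ) := lieDeriv_mul (rotGen i j)
    (hf.differentiable (by simp) z) (hg.differentiable (by simp) z)
  change ∫ z, lieDeriv (rotGen i j) (fun w => f w * g w) z = 0 at hprod
  simp only [hleibniz] at hprod
  rw [integral_add (integrable_mul_of_hasCompactSupport hf.continuous hc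
      (contDiff_lieDeriv _ hg).continuous)
    (integrable_mul_of_hasCompactSupport (contDiff_lieDeriv _ hf).continuous
      (hasCompactSupport_lieDeriv _ hc) hg.continuous)] at hprod
  exact eq_neg_of_add_eq_zero_right hprod

theorem integral_lieDeriv_rotGen_sq_mul {f g : (ι → ℝ) → ℂ} (hf : ContDiff ℝ ∞ f)
    (hc : HasCompactSupport f) (hg : ContDiff ℝ ∞ g) (i j : ι) :
    ∫ z, lieDeriv (rotGen i j) (lieDeriv (rotGen i j) f) z * g z =
      ∫ z, f z * lieDeriv (rotGen i j) (lieDeriv (rotGen i j) g) z := by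
  rw [integral_lieDeriv_rotGen_mul (contDiff_lieDeriv _ hf) (hasCompactSupport_lieDeriv _ hc) hg,
    integral_lieDeriv_rotGen_mul hf hc (contDiff_lieDeriv _ hg), neg_neg]

variable {κ : Type*} [Fintype κ] (e : κ → ι)

theorem integral_angular_mul {f g : (ι → ℝ) → ℂ} (hf : ContDiff ℝ ∞ f)
    (hc : HasCompactSupport f) (hg : ContDiff ℝ ∞ g) :
    ∫ z, angular e f z * g z = ∫ z, f z * angular e g z := by
  have hintf (i j : κ) : Integrable fun z =>
      lieDeriv (rotGen (e i) (e j)) (lieDeriv (rotGen (e i) (e j)) f) z * g z :=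
    integrable_mul_of_hasCompactSupport (contDiff_lieDeriv _ (contDiff_lieDeriv _ hf)).continuous
      (hasCompactSupport_lieDeriv _ (hasCompactSupport_lieDeriv _ hc)) hg.continuous
  have hintg (i j : κ) : Integrable fun z =>
      f z * lieDeriv (rotGen (e i) (e j)) (lieDeriv (rotGen (e i) (e j)) g) z :=
    integrable_mul_of_hasCompactSupport hf.continuous hc
      (contDiff_lieDeriv _ (contDiff_lieDeriv _ hg)).continuous
  simp only [angular, mul_left_comm (f _), mul_assoc, Finset.sum_mul, integral_const_mul]
  have hexpand (z : ι → ℝ) :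
      f z * ∑ i, ∑ j, lieDeriv (rotGen (e i) (e j)) (lieDeriv (rotGen (e i) (e j)) g) z =
        ∑ i, ∑ j, f z *
          lieDeriv (rotGen (e i) (e j)) (lieDeriv (rotGen (e i) (e j)) g) z := by
    simp only [Finset.mul_sum]
  simp only [hexpand]
  rw [integral_finsetSum _ fun i _ => integrable_finsetSum _ fun j _ => hintf i j,
    integral_finsetSum _ fun i _ => integrable_finsetSum _ fun j _ => hintg i j]
  simp only [integral_finsetSum _ fun j _ => hintf _ j,
    integral_finsetSum _ fun j _ => hintg _ j, integral_lieDeriv_rotGen_sq_mul hf hc hg]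

theorem integrable_angular_mul {f g : (ι → ℝ) → ℂ} (hf : ContDiff ℝ ∞ f)
    (hc : HasCompactSupport f) (hg : Continuous g) : Integrable fun z => angular e f z * g z := by
  refine integrable_mul_of_hasCompactSupport (contDiff_angular e hf).continuous
    (.intro hc.isCompact fun z hz => ?_) hg
  have hzero (A : (ι → ℝ) →L[ℝ] (ι → ℝ)) : lieDeriv A (0 : (ι → ℝ) → ℂ) = 0 := by
    funext w
    rw [lieDeriv, fderiv_zero]
    rfl
  rw [angular_congr e (notMem_tsupport_iff_eventuallyEq.1 hz)]
  simp only [angular, hzero, Pi.zero_apply, Finset.sum_const_zero, mul_zero]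

end AngularSymmetry

section Powers

theorem lieDeriv_mul_of_invariant {E : Type*} [NormedAddCommGroup E] [NormedSpace ℝ E]
    {A : E →L[ℝ] E} {f g : E → ℂ} {z : E} (hg : Differentiable ℝ g) (h : lieDeriv A g = 0)
    (hf : DifferentiableAt ℝ f z) :
    lieDeriv A (fun w => g w * f w) z = g z * lieDeriv A f z := by
  rw [lieDeriv_mul A (hg z) hf, h, Pi.zero_apply, zero_mul, add_zero]

variable {ι : Type*} [Fintype ι] [DecidableEq ι] {κ : Type*} [Fintype κ] {e : κ → ι}

theorem angular_mul_of_invariant {f g : (ι → ℝ) → ℂ} {z : ι → ℝ} (hg : Differentiable ℝ g)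
    (h : ∀ i j, lieDeriv (rotGen (e i) (e j)) g = 0) (hf : ContDiffAt ℝ 2 f z) :
    angular e (fun w => g w * f w) z = g z * angular e f z := by
  have hfirst (i j : κ) : lieDeriv (rotGen (e i) (e j)) (fun w => g w * f w) =ᶠ[nhds z]
      fun w => g w * lieDeriv (rotGen (e i) (e j)) f w := by
    filter_upwards [hf.eventually (by simp)] with w hw
    exact lieDeriv_mul_of_invariant hg (h i j) (hw.differentiableAt two_ne_zero)
  have hsecond (i j : κ) := (lieDeriv_congr (rotGen (e i) (e j)) (hfirst i j)).eq_of_nhds.trans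
    (lieDeriv_mul_of_invariant hg (h i j) (differentiableAt_lieDeriv _ hf))
  simp only [angular, hsecond, ← Finset.mul_sum]
  ring

theorem lieDeriv_rotGen_eq_zero {i j : ι} {g : (ι → ℝ) → ℂ} (hg : Differentiable ℝ g)
    (h : i ≠ j → ∀ t z, g (rot i j t z) = g z) : lieDeriv (rotGen i j) g = 0 := by
  funext z
  by_cases hij : i = j
  · rw [hij, rotGen_self, lieDeriv_zero, Pi.zero_apply]
  · rw [lieDeriv_eq_of_curve (hasDerivAt_rot i j z) (rot_zero i j z) (hg z)
      (differentiableAt_const (g z)) (h hij · z), lieDeriv, fderiv_const_apply]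
    rfl

theorem fderiv_pow_clm {E : Type*} [NormedAddCommGroup E] [NormedSpace ℝ E] (l : E →L[ℝ] ℂ)
    (a : ℕ) : fderiv ℝ (fun z => l z ^ a) = fun z => (a * l z ^ (a - 1)) • l := by
  funext z
  rw [(l.hasFDerivAt.pow a).fderiv]
  simp

theorem fderiv_fderiv_pow_clm {E : Type*} [NormedAddCommGroup E] [NormedSpace ℝ E]
    (l : E →L[ℝ] ℂ) (a : ℕ) (z v w : E) :
    fderiv ℝ (fderiv ℝ fun z => l z ^ a) z v w =
      a * ((a - 1 : ℕ) * l z ^ (a - 2)) * l v * l w := by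
  have h := (((l.hasFDerivAt (x := z)).pow (a - 1)).const_mul (a : ℂ)).smul_const l
  rw [fderiv_pow_clm, h.fderiv]
  simp [mul_assoc, Nat.sub_sub]

theorem angular_pow (he : Function.Injective e) (l : (ι → ℝ) →L[ℝ] ℂ) (a : ℕ)
    {z : ι → ℝ} (h : l (block e z) = l z) :
    angular e (fun z => l z ^ a) z =
      -((a : ℂ) * (a + Fintype.card κ - 2)) * l z ^ a +
        a * ((a : ℂ) - 1) * (∑ i, l (Pi.single (e i) 1) ^ 2) *
          (((∑ i, z (e i) ^ 2 : ℝ) : ℂ) * l z ^ (a - 2)) := by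
  rw [angular_eq (l.contDiff.pow a).contDiffAt he]
  simp only [fderiv_fderiv_pow_clm]
  simp only [fderiv_pow_clm, smul_apply, smul_eq_mul, h]
  rcases a with _ | _ | a
  · simp
  · simp
    ring
  · simp only [Nat.add_sub_cancel, mul_assoc, ← pow_two, ← Finset.mul_sum]
    push_cast
    ring

end Powers

section Moments

open MeasureTheory

variable {ι : Type*} [Fintype ι]

theorem integral_mul_exp_clm_eq_zero {W : (ι → ℝ) → ℂ} (hW : Continuous W)
    (hc : HasCompactSupport W) (l : (ι → ℝ) →L[ℝ] ℂ) (h : ∀ n : ℕ, ∫ z, W z * l z ^ n = 0) :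
    ∫ z, W z * Complex.exp (l z) = 0 := by
  obtain ⟨R, hR⟩ : ∃ R : ℝ, ∀ z ∈ tsupport W, ‖l z‖ ≤ R :=
    hc.isCompact.exists_bound_of_continuousOn l.continuous.continuousOn
  have hint : ∀ n : ℕ, Integrable fun z => W z * (l z ^ n / n.factorial) := fun n =>
    integrable_mul_of_hasCompactSupport hW hc (by fun_prop)
  have hWn : Integrable fun z => ‖W z‖ := (hW.integrable_of_hasCompactSupport hc).norm
  have hbound : ∀ (n : ℕ) (z : ι → ℝ),
      ‖W z * (l z ^ n / n.factorial)‖ ≤ ‖W z‖ * (R ^ n / n.factorial) := by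
    intro n z
    by_cases hz : z ∈ tsupport W
    · rw [norm_mul, norm_div, norm_pow, Complex.norm_natCast]
      gcongr
      exact hR z hz
    · simp [image_eq_zero_of_notMem_tsupport hz]
  have hsum : Summable fun n : ℕ => ∫ z, ‖W z * (l z ^ n / n.factorial)‖ := by
    refine Summable.of_nonneg_of_le (fun n => integral_nonneg fun _ => norm_nonneg _)
      (fun n => ?_) ((Real.summable_pow_div_factorial R).mul_left (∫ z, ‖W z‖))
    rw [← integral_mul_const]
    exact integral_mono (hint n).norm (hWn.mul_const _) (hbound n)
  have hexp (z : ι → ℝ) :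
      ∑' n : ℕ, W z * (l z ^ n / n.factorial) = W z * Complex.exp (l z) := by
    rw [tsum_mul_left, Complex.exp_eq_exp_ℂ, NormedSpace.exp_eq_tsum_div]
  have hs := hasSum_integral_of_summable_integral_norm hint hsum
  simp only [hexp] at hs
  simp only [← mul_div_assoc, integral_div, h, zero_div] at hs
  exact hs.unique hasSum_zero

theorem eq_zero_of_fourier_eq_zero {W : (ι → ℝ) → ℂ} (hW : Continuous W)
    (hc : HasCompactSupport W)
    (h : ∀ ζ : ι → ℝ, ∫ z, W z * Complex.exp (-(2 * Real.pi * Complex.I) * ∑ i, ζ i * z i) = 0) :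
    W = 0 := by
  set W' : EuclideanSpace ℝ ι → ℂ := fun v => W (WithLp.ofLp v)
  have hvp := PiLp.volume_preserving_ofLp ι
  have hemb : MeasurableEmbedding (WithLp.ofLp : EuclideanSpace ℝ ι → ι → ℝ) :=
    (MeasurableEquiv.toLp 2 (ι → ℝ)).symm.measurableEmbedding
  have hW' : Continuous W' := hW.comp (PiLp.continuous_ofLp 2 _)
  have hi : Integrable W' :=
    (hvp.integrable_comp_emb hemb).2 (hW.integrable_of_hasCompactSupport hc)
  have hF : FourierTransform.fourier W' = 0 := by
    funext w
    rw [Real.fourier_eq', Pi.zero_apply, ← h (WithLp.ofLp w), ← hvp.integral_comp hemb]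
    refine integral_congr_ae (.of_forall fun v => ?_)
    simp only [smul_eq_mul, W', PiLp.inner_apply, RCLike.inner_apply, conj_trivial]
    rw [mul_comm]
    push_cast
    ring_nf
  have hinv := hW'.fourierInv_fourier_eq hi (by rw [hF]; exact integrable_zero _ _ _)
  rw [hF] at hinv
  funext z
  simpa [Real.fourierInv_eq', W'] using (congrFun hinv (WithLp.toLp 2 z)).symm

variable {p q : ℕ}

theorem block_inr_rot_inl (i j : Fin p) (t : ℝ) (z : Space p q) :
    block Sum.inr (rot (Sum.inl i) (Sum.inl j) t z) = block Sum.inr z := by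
  simp only [block, rot_apply_of_ne Sum.inr_ne_inl Sum.inr_ne_inl]

theorem block_inl_rot_inr (i j : Fin q) (t : ℝ) (z : Space p q) :
    block Sum.inl (rot (Sum.inr i) (Sum.inr j) t z) = block Sum.inl z := by
  simp only [block, rot_apply_of_ne Sum.inl_ne_inr Sum.inl_ne_inr]

/-- The test functions `|x|²ᵏ |y|²ᵐ l₁ᵃ l₂ᵇ` for linear forms `l₁`, `l₂`. The factors `|x|²ᵏ`
and `|y|²ᵐ` make the family stable under the angular operators. -/
def testFn (l₁ l₂ : Space p q →L[ℝ] ℂ) (k m a b : ℕ) (z : Space p q) : ℂ :=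
  ((∑ i, z (Sum.inl i) ^ 2 : ℝ) : ℂ) ^ k * ((∑ i, z (Sum.inr i) ^ 2 : ℝ) : ℂ) ^ m *
    l₁ z ^ a * l₂ z ^ b

theorem contDiff_testFn (l₁ l₂ : Space p q →L[ℝ] ℂ) (k m a b : ℕ) :
    ContDiff ℝ ∞ (testFn l₁ l₂ k m a b) := by
  have hx : ContDiff ℝ ∞ fun z : Space p q => ∑ i, z (Sum.inl i) ^ 2 := by fun_prop
  have hy : ContDiff ℝ ∞ fun z : Space p q => ∑ i, z (Sum.inr i) ^ 2 := by fun_prop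
  exact ((((Complex.ofRealCLM.contDiff.comp hx).pow k).mul
    ((Complex.ofRealCLM.contDiff.comp hy).pow m)).mul (l₁.contDiff.pow a)).mul
      (l₂.contDiff.pow b)

variable {l₁ l₂ : Space p q →L[ℝ] ℂ}

theorem angular_inl_testFn (h₁ : ∀ z, l₁ (block Sum.inl z) = l₁ z)
    (h₂ : ∀ z, l₂ (block Sum.inr z) = l₂ z) (k m a b : ℕ) (z : Space p q) :
    angular Sum.inl (testFn l₁ l₂ k m a b) z =
      -((a : ℂ) * (a + p - 2)) * testFn l₁ l₂ k m a b z +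
        a * ((a : ℂ) - 1) * (∑ i : Fin p, l₁ (Pi.single (Sum.inl i) 1) ^ 2) *
          testFn l₁ l₂ (k + 1) m (a - 2) b z := by
  have hfactor : testFn l₁ l₂ k m a b = fun z => testFn l₁ l₂ k m 0 b z * l₁ z ^ a := by
    funext z
    simp only [testFn, pow_zero, mul_one]
    ring
  have hdiff := (contDiff_testFn l₁ l₂ k m 0 b).differentiable (by simp)
  rw [hfactor, angular_mul_of_invariant hdiff
    (fun i j => lieDeriv_rotGen_eq_zero hdiff fun hij t z => ?_) (l₁.contDiff.pow a).contDiffAt,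
    angular_pow Sum.inl_injective l₁ a (h₁ z)]
  · simp only [testFn, Fintype.card_fin]
    ring
  · simp only [testFn, pow_zero, mul_one, sum_sq_rot Sum.inl_injective (ne_of_apply_ne _ hij),
      rot_apply_of_ne Sum.inr_ne_inl Sum.inr_ne_inl]
    rw [← h₂, block_inr_rot_inl, h₂]

theorem angular_inr_testFn (h₁ : ∀ z, l₁ (block Sum.inl z) = l₁ z)
    (h₂ : ∀ z, l₂ (block Sum.inr z) = l₂ z) (k m a b : ℕ) (z : Space p q) :
    angular Sum.inr (testFn l₁ l₂ k m a b) z =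
      -((b : ℂ) * (b + q - 2)) * testFn l₁ l₂ k m a b z +
        b * ((b : ℂ) - 1) * (∑ i : Fin q, l₂ (Pi.single (Sum.inr i) 1) ^ 2) *
          testFn l₁ l₂ k (m + 1) a (b - 2) z := by
  have hfactor : testFn l₁ l₂ k m a b = fun z => testFn l₁ l₂ k m a 0 z * l₂ z ^ b := by
    funext z
    simp only [testFn, pow_zero, mul_one]
  have hdiff := (contDiff_testFn l₁ l₂ k m a 0).differentiable (by simp)
  rw [hfactor, angular_mul_of_invariant hdiff
    (fun i j => lieDeriv_rotGen_eq_zero hdiff fun hij t z => ?_) (l₂.contDiff.pow b).contDiffAt,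
    angular_pow Sum.inr_injective l₂ b (h₂ z)]
  · simp only [testFn, Fintype.card_fin]
    ring
  · simp only [testFn, pow_zero, mul_one, sum_sq_rot Sum.inr_injective (ne_of_apply_ne _ hij),
      rot_apply_of_ne Sum.inl_ne_inr Sum.inl_ne_inr]
    rw [← h₁, block_inl_rot_inr, h₁]

theorem testFn_neg (k m a b : ℕ) (z : Space p q) :
    testFn l₁ l₂ k m a b (-z) = (-1) ^ (a + b) * testFn l₁ l₂ k m a b z := by
  simp only [testFn, map_neg, Pi.neg_apply, neg_sq]
  rw [neg_pow (l₁ z), neg_pow (l₂ z)]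
  ring

/-- Completing the squares, equality would mean `(b + (q - 2) / 2) ^ 2 = (a + (p - 2) / 2) ^ 2`,
hence `b - a = (p - q) / 2`. -/
theorem eigenvalue_sub_yamabeConst_ne_zero (hp : 2 ≤ p) (hq : 2 ≤ q) {r : ℤ}
    (hr : (p : ℤ) - q = 2 * r) {a b : ℕ}
    (hab : ¬ Even ((a : ℤ) + b - r)) :
    -((a : ℂ) * (a + p - 2)) + (b : ℂ) * (b + q - 2) - yamabeConst p q ≠ 0 := by
  intro h
  have hsq : ((2 * b + q - 2 : ℤ) : ℂ) ^ 2 = ((2 * a + p - 2 : ℤ) : ℂ) ^ 2 := by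
    rw [yamabeConst] at h
    push_cast
    linear_combination 4 * h
  have heq : (2 * b + q - 2 : ℤ) = 2 * a + p - 2 :=
    (pow_left_inj₀ (by omega) (by omega) two_ne_zero).1 (by exact_mod_cast hsq)
  exact hab ⟨a, by omega⟩

theorem integral_mul_testFn_eq_zero_of_even {r : ℤ} {W : Space p q → ℂ}
    (hanti : ∀ z, W (-z) = -(-1) ^ r * W z) (k m : ℕ) {a b : ℕ} (hab : Even ((a : ℤ) + b - r)) :
    ∫ z, W z * testFn l₁ l₂ k m a b z = 0 := by
  have hsign : (-1 : ℂ) ^ r * (-1) ^ (a + b) = 1 := by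
    rw [← zpow_natCast, ← zpow_add₀ (by norm_num)]
    refine Even.neg_one_zpow ?_
    obtain ⟨c, hc⟩ := hab
    exact ⟨c + r, by push_cast; linarith⟩
  have hodd (z : Space p q) :
      W (-z) * testFn l₁ l₂ k m a b (-z) = -(W z * testFn l₁ l₂ k m a b z) := by
    rw [hanti, testFn_neg]
    linear_combination -(W z * testFn l₁ l₂ k m a b z) * hsign
  have hneg := integral_neg_eq_self (fun z => W z * testFn l₁ l₂ k m a b z) volume
  simp only [hodd, integral_neg] at hneg
  exact self_eq_neg.1 hneg.symm

theorem integral_mul_testFn_recursion {W : Space p q → ℂ} (hW : ContDiff ℝ ∞ W)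
    (hc : HasCompactSupport W)
    (hPDE : ∀ z, angular Sum.inl W z - angular Sum.inr W z = yamabeConst p q * W z)
    (h₁ : ∀ z, l₁ (block Sum.inl z) = l₁ z) (h₂ : ∀ z, l₂ (block Sum.inr z) = l₂ z)
    (k m a b : ℕ) :
    (-((a : ℂ) * (a + p - 2)) + (b : ℂ) * (b + q - 2) - yamabeConst p q) *
        ∫ z, W z * testFn l₁ l₂ k m a b z =
      b * ((b : ℂ) - 1) * (∑ i : Fin q, l₂ (Pi.single (Sum.inr i) 1) ^ 2) *
          (∫ z, W z * testFn l₁ l₂ k (m + 1) a (b - 2) z) -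
        a * ((a : ℂ) - 1) * (∑ i : Fin p, l₁ (Pi.single (Sum.inl i) 1) ^ 2) *
          ∫ z, W z * testFn l₁ l₂ (k + 1) m (a - 2) b z := by
  have hint (k m a b : ℕ) : Integrable fun z => W z * testFn l₁ l₂ k m a b z :=
    integrable_mul_of_hasCompactSupport hW.continuous hc (contDiff_testFn l₁ l₂ k m a b).continuous
  have hT := contDiff_testFn l₁ l₂ k m a b
  have hinl := integral_angular_mul Sum.inl hW hc hT
  have hinr := integral_angular_mul Sum.inr hW hc hT
  have hsub : (∫ z, angular Sum.inl W z * testFn l₁ l₂ k m a b z) -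
      ∫ z, angular Sum.inr W z * testFn l₁ l₂ k m a b z =
        yamabeConst p q * ∫ z, W z * testFn l₁ l₂ k m a b z := by
    rw [← integral_sub (integrable_angular_mul Sum.inl hW hc hT.continuous)
      (integrable_angular_mul Sum.inr hW hc hT.continuous)]
    simp only [← sub_mul, hPDE, mul_assoc, integral_const_mul]
  simp only [angular_inl_testFn h₁ h₂, angular_inr_testFn h₁ h₂, mul_add, mul_left_comm (W _)]
    at hinl hinr
  rw [integral_add ((hint _ _ _ _).const_mul _) ((hint _ _ _ _).const_mul _),
    integral_const_mul, integral_const_mul] at hinl hinr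
  rw [hinl, hinr] at hsub
  linear_combination hsub

theorem integral_mul_testFn_eq_zero (hp : 2 ≤ p) (hq : 2 ≤ q) {r : ℤ}
    (hr : (p : ℤ) - q = 2 * r) {W : Space p q → ℂ} (hW : ContDiff ℝ ∞ W)
    (hc : HasCompactSupport W)
    (hPDE : ∀ z, angular Sum.inl W z - angular Sum.inr W z = yamabeConst p q * W z)
    (hanti : ∀ z, W (-z) = -(-1) ^ r * W z)
    (h₁ : ∀ z, l₁ (block Sum.inl z) = l₁ z) (h₂ : ∀ z, l₂ (block Sum.inr z) = l₂ z)
    (k m a b : ℕ) : ∫ z, W z * testFn l₁ l₂ k m a b z = 0 := by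
  induction hn : a + b using Nat.strong_induction_on generalizing k m a b with
  | _ n ih =>
  by_cases hab : Even ((a : ℤ) + b - r)
  · exact integral_mul_testFn_eq_zero_of_even hanti k m hab
  have hlower_a (s : ℂ) : a * ((a : ℂ) - 1) * s *
      ∫ z, W z * testFn l₁ l₂ (k + 1) m (a - 2) b z = 0 := by
    rcases a with _ | _ | a
    · simp
    · simp
    · simp [ih (a + b) (by omega) _ _ a b rfl]
  have hlower_b (s : ℂ) : b * ((b : ℂ) - 1) * s *
      ∫ z, W z * testFn l₁ l₂ k (m + 1) a (b - 2) z = 0 := by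
    rcases b with _ | _ | b
    · simp
    · simp
    · simp [ih (a + b) (by omega) _ _ a b rfl]
  have hrec := integral_mul_testFn_recursion hW hc hPDE h₁ h₂ k m a b
  rw [hlower_a, hlower_b, sub_zero] at hrec
  exact (mul_eq_zero.1 hrec).resolve_left (eigenvalue_sub_yamabeConst_ne_zero hp hq hr hab)

/-- The character `z ↦ -2πi ⟨ζ, z⟩` in the exponent of the Fourier transform, as a linear form. -/
def fourierForm (ζ : Space p q) : Space p q →L[ℝ] ℂ :=
  ∑ k, (-(2 * Real.pi * Complex.I) * ζ k) • Complex.ofRealCLM.comp (ContinuousLinearMap.proj k)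

theorem fourierForm_apply (ζ z : Space p q) :
    fourierForm ζ z = -(2 * Real.pi * Complex.I) * ((∑ k, ζ k * z k : ℝ) : ℂ) := by
  rw [fourierForm, sum_apply, Complex.ofReal_sum, Finset.mul_sum]
  exact Finset.sum_congr rfl fun k _ => by simp [mul_assoc]

theorem fourierForm_block_inl (ζ z : Space p q) :
    fourierForm (block Sum.inl ζ) (block Sum.inl z) = fourierForm (block Sum.inl ζ) z := by
  simp [fourierForm_apply, block_inl, Fintype.sum_sum_type]

theorem fourierForm_block_inr (ζ z : Space p q) :
    fourierForm (block Sum.inr ζ) (block Sum.inr z) = fourierForm (block Sum.inr ζ) z := by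
  simp [fourierForm_apply, block_inr, Fintype.sum_sum_type]

theorem fourierForm_block_inl_add_block_inr (ζ z : Space p q) :
    (fourierForm (block Sum.inl ζ) + fourierForm (block Sum.inr ζ)) z =
      -(2 * Real.pi * Complex.I) * ((∑ k, ζ k * z k : ℝ) : ℂ) := by
  simp [fourierForm_apply, block_inl, block_inr, Fintype.sum_sum_type]
  ring

theorem eq_zero_of_angular_eq (hp : 2 ≤ p) (hq : 2 ≤ q) {r : ℤ}
    (hr : (p : ℤ) - q = 2 * r) {W : Space p q → ℂ} (hW : ContDiff ℝ ∞ W)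
    (hc : HasCompactSupport W)
    (hPDE : ∀ z, angular Sum.inl W z - angular Sum.inr W z = yamabeConst p q * W z)
    (hanti : ∀ z, W (-z) = -(-1) ^ r * W z) : W = 0 := by
  refine eq_zero_of_fourier_eq_zero hW.continuous hc fun ζ => ?_
  set l₁ := fourierForm (block Sum.inl ζ)
  set l₂ := fourierForm (block Sum.inr ζ)
  simp only [← fourierForm_block_inl_add_block_inr]
  refine integral_mul_exp_clm_eq_zero hW.continuous hc (l₁ + l₂) fun n => ?_
  have hbinomial (z : Space p q) : W z * (l₁ + l₂) z ^ n = ∑ j ∈ Finset.range (n + 1),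
      W z * testFn l₁ l₂ 0 0 j (n - j) z * (n.choose j : ℂ) := by
    simp [add_pow, Finset.mul_sum, testFn, mul_assoc]
  simp only [hbinomial]
  rw [integral_finsetSum]
  · refine Finset.sum_eq_zero fun j _ => ?_
    rw [integral_mul_const, integral_mul_testFn_eq_zero hp hq hr hW hc hPDE hanti
      (fourierForm_block_inl ζ) (fourierForm_block_inr ζ), zero_mul]
  · exact fun j _ => (integrable_mul_of_hasCompactSupport hW.continuous hc
      (contDiff_testFn l₁ l₂ 0 0 j (n - j)).continuous).mul_const _

end Moments

section Parity

variable {p q : ℕ}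

theorem normX_neg (z : Space p q) : normX (-z) = normX z := by simp [normX]

theorem normY_neg (z : Space p q) : normY (-z) = normY z := by simp [normY]

theorem radial_neg (z : Space p q) : radial (-z) = -radial z := by
  funext k
  cases k <;> simp [radial, normX_neg, normY_neg, neg_div]

theorem neg_mem_spheres {v : Space p q} (hv : v ∈ spheres p q) : -v ∈ spheres p q :=
  ⟨(normX_neg v).trans hv.1, (normY_neg v).trans hv.2⟩

/-- The antipodal map of `M`. -/
def negM (z : spheres p q) : spheres p q := ⟨-(z : Space p q), neg_mem_spheres z.2⟩

theorem negM_negM (z : spheres p q) : negM (negM z) = z := Subtype.ext (neg_neg _)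

theorem extend_neg {f : spheres p q → ℂ} {c : ℂ} (h : ∀ z, f (negM z) = c * f z) (v : Space p q) :
    extend f (-v) = c * extend f v := by
  by_cases hv : radial v ∈ spheres p q
  · have hneg : radial (-v) ∈ spheres p q := radial_neg v ▸ neg_mem_spheres hv
    rw [extend, dif_pos hneg, extend, dif_pos hv, ← h]
    exact congrArg f (Subtype.ext (radial_neg v))
  · have hneg : radial (-v) ∉ spheres p q := fun hn => hv <| by
      simpa only [radial_neg, neg_neg] using neg_mem_spheres hn
    rw [extend, dif_neg hneg, extend, dif_neg hv, mul_zero]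

theorem normX_sq (z : Space p q) : normX z ^ 2 = ∑ i, z (Sum.inl i) ^ 2 :=
  Real.sq_sqrt (Finset.sum_nonneg fun _ _ => sq_nonneg _)

theorem normY_sq (z : Space p q) : normY z ^ 2 = ∑ i, z (Sum.inr i) ^ 2 :=
  Real.sq_sqrt (Finset.sum_nonneg fun _ _ => sq_nonneg _)

theorem abs_inl_le_normX (z : Space p q) (i : Fin p) : |z (Sum.inl i)| ≤ normX z :=
  Real.abs_le_sqrt <| Finset.single_le_sum (f := fun i => z (Sum.inl i) ^ 2)
    (fun _ _ => sq_nonneg _) (Finset.mem_univ i)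

theorem abs_inr_le_normY (z : Space p q) (j : Fin q) : |z (Sum.inr j)| ≤ normY z :=
  Real.abs_le_sqrt <| Finset.single_le_sum (f := fun j => z (Sum.inr j) ^ 2)
    (fun _ _ => sq_nonneg _) (Finset.mem_univ j)

variable (p q) in
/-- A compact neighbourhood of `M` which avoids `x = 0` and `y = 0`. -/
def collar : Set (Space p q) :=
  {z | normX z ^ 2 ∈ Metric.closedBall 1 (1 / 2) ∧ normY z ^ 2 ∈ Metric.closedBall 1 (1 / 2)}

theorem isClosed_collar : IsClosed (collar p q) :=
  (Metric.isClosed_closedBall.preimage (continuous_normX.pow 2)).inter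
    (Metric.isClosed_closedBall.preimage (continuous_normY.pow 2))

theorem isCompact_collar : IsCompact (collar p q) := by
  refine (isCompact_closedBall (0 : Space p q) 2).of_isClosed_subset isClosed_collar
    fun z ⟨hx, hy⟩ => ?_
  rw [Real.closedBall_eq_Icc] at hx hy
  have hx2 : normX z ≤ 2 := le_of_sq_le_sq (by linarith [hx.2]) zero_le_two
  have hy2 : normY z ≤ 2 := le_of_sq_le_sq (by linarith [hy.2]) zero_le_two
  rw [mem_closedBall_zero_iff, pi_norm_le_iff_of_nonneg zero_le_two]
  rintro (i | j)
  · exact (abs_inl_le_normX z i).trans hx2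
  · exact (abs_inr_le_normY z j).trans hy2

theorem pos_of_mem_collar {z : Space p q} (hz : z ∈ collar p q) : 0 < normX z ∧ 0 < normY z := by
  obtain ⟨hx, hy⟩ := hz
  rw [Real.closedBall_eq_Icc] at hx hy
  exact ⟨(normX_nonneg z).lt_of_ne' (pow_ne_zero_iff two_ne_zero |>.1 (by linarith [hx.1])),
    (normY_nonneg z).lt_of_ne' (pow_ne_zero_iff two_ne_zero |>.1 (by linarith [hy.1]))⟩

/-- A bump function on the real line, equal to `1` near `1` and supported in `[1/2, 3/2]`. -/
def bumpOne : ContDiffBump (1 : ℝ) := ⟨1 / 4, 1 / 2, by norm_num, by norm_num⟩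

/-- A smooth function of `|x|²` and `|y|²` which is `1` on `M` and vanishes outside `collar`. -/
def cutoff (z : Space p q) : ℂ := ((bumpOne (normX z ^ 2) * bumpOne (normY z ^ 2) : ℝ) : ℂ)

theorem contDiff_cutoff : ContDiff ℝ ∞ (cutoff : Space p q → ℂ) := by
  have hx : ContDiff ℝ ∞ fun z : Space p q => normX z ^ 2 := by
    simp only [normX_sq]
    fun_prop
  have hy : ContDiff ℝ ∞ fun z : Space p q => normY z ^ 2 := by
    simp only [normY_sq]
    fun_prop
  exact Complex.ofRealCLM.contDiff.comp
    ((bumpOne.contDiff.comp hx).mul (bumpOne.contDiff.comp hy))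

theorem cutoff_of_mem (z : spheres p q) : cutoff (z : Space p q) = 1 := by
  have h : bumpOne 1 = 1 := bumpOne.one_of_mem_closedBall (by simp [bumpOne])
  rw [cutoff, z.2.1, z.2.2, one_pow, h, mul_one, Complex.ofReal_one]

theorem cutoff_neg (z : Space p q) : cutoff (-z) = cutoff z := by
  rw [cutoff, normX_neg, normY_neg, cutoff]

theorem cutoff_of_notMem_collar {z : Space p q} (hz : z ∉ collar p q) : cutoff z = 0 := by
  have hbump {t : ℝ} (ht : t ∉ Metric.closedBall (1 : ℝ) (1 / 2)) : bumpOne t = 0 :=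
    bumpOne.zero_of_le_dist (le_of_not_ge ht)
  rw [cutoff, Complex.ofReal_eq_zero, mul_eq_zero]
  exact (not_and_or.1 hz).imp hbump hbump

theorem hasCompactSupport_cutoff_mul (u : Space p q → ℂ) :
    HasCompactSupport fun z => cutoff z * u z :=
  HasCompactSupport.intro isCompact_collar fun _ hz => by rw [cutoff_of_notMem_collar hz, zero_mul]

theorem cutoff_mul_eventuallyEq_zero (u : Space p q → ℂ) {z : Space p q} (hz : z ∉ collar p q) :
    (fun w => cutoff w * u w) =ᶠ[nhds z] fun _ => 0 := by
  filter_upwards [isClosed_collar.isOpen_compl.mem_nhds hz] with w hw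
  rw [cutoff_of_notMem_collar hw, zero_mul]

theorem contDiff_cutoff_mul_extend {f : spheres p q → ℂ} (hf : f ∈ SmoothM p q) :
    ContDiff ℝ ∞ fun z => cutoff z * extend f z := by
  rw [contDiff_iff_contDiffAt]
  intro z
  by_cases hz : z ∈ collar p q
  · exact contDiff_cutoff.contDiffAt.mul
      (contDiffAt_extend_of_pos hf (pos_of_mem_collar hz).1 (pos_of_mem_collar hz).2)
  · exact contDiffAt_const.congr_of_eventuallyEq (cutoff_mul_eventuallyEq_zero _ hz)

theorem lieDeriv_rotGen_inl_cutoff (i j : Fin p) :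
    lieDeriv (rotGen (Sum.inl i) (Sum.inl j)) (cutoff : Space p q → ℂ) = 0 :=
  lieDeriv_rotGen_eq_zero (contDiff_cutoff.differentiable (by simp)) fun hij t z => by
    rw [cutoff, normX_rot_inl (ne_of_apply_ne _ hij), normY_rot_inl, cutoff]

theorem lieDeriv_rotGen_inr_cutoff (i j : Fin q) :
    lieDeriv (rotGen (Sum.inr i) (Sum.inr j)) (cutoff : Space p q → ℂ) = 0 :=
  lieDeriv_rotGen_eq_zero (contDiff_cutoff.differentiable (by simp)) fun hij t z => by
    rw [cutoff, normX_rot_inr, normY_rot_inr (ne_of_apply_ne _ hij), cutoff]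

theorem angular_cutoff_mul_extend {κ : Type*} [Fintype κ] {e : κ → Fin p ⊕ Fin q}
    (he : ∀ i j, lieDeriv (rotGen (e i) (e j)) cutoff = 0) {f : spheres p q → ℂ}
    (hf : f ∈ SmoothM p q) (z : Space p q) :
    angular e (fun w => cutoff w * extend f w) z = cutoff z * angular e (extend f) z := by
  by_cases hz : z ∈ collar p q
  · obtain ⟨hx, hy⟩ := pos_of_mem_collar hz
    exact angular_mul_of_invariant (contDiff_cutoff.differentiable (by simp)) he
      ((contDiffAt_extend_of_pos hf hx hy).of_le (WithTop.coe_le_coe.2 le_top))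
  · rw [angular_congr e (cutoff_mul_eventuallyEq_zero _ hz), cutoff_of_notMem_collar hz]
    have hzero (i j : κ) : lieDeriv (rotGen (e i) (e j)) (fun _ => (0 : ℂ)) = fun _ => 0 := by
      funext w
      rw [lieDeriv, fderiv_const_apply, zero_apply]
    simp only [angular, hzero, Finset.sum_const_zero, mul_zero, zero_mul]

theorem angular_comp_mul_left {ι κ : Type*} [Fintype ι] [DecidableEq ι] [Fintype κ] {e : κ → ι}
    {c : ι → ℝ} (hc : ∀ k, c k ≠ 0) (hce : ∀ i j, c (e i) = c (e j)) (f : (ι → ℝ) → ℂ)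
    (z : ι → ℝ) : angular e (fun w => f (c * w)) z = angular e f (c * z) := by
  set S : (ι → ℝ) ≃L[ℝ] (ι → ℝ) := ContinuousLinearEquiv.piCongrRight fun k =>
    ContinuousLinearEquiv.unitsEquivAut ℝ (Units.mk0 (c k) (hc k))
  have hS (w : ι → ℝ) : S w = c * w := by
    funext k
    simp [S, mul_comm]
  simp only [← hS]
  refine angular_comp_equiv S (fun i j w => ?_) f z
  funext k
  simp only [hS, rotGen_apply, Pi.mul_apply, Pi.sub_apply, Pi.smul_apply, smul_eq_mul,
    Pi.single_apply]
  grind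

theorem angular_extend_radial {κ : Type*} [Fintype κ] {e : κ → Fin p ⊕ Fin q}
    (he : ∀ i j, (e i).isLeft = (e j).isLeft) (f : spheres p q → ℂ) {z : Space p q}
    (hx : 0 < normX z) (hy : 0 < normY z) :
    angular e (extend f) (radial z) = angular e (extend f) z := by
  set c : Space p q := fun k => bif k.isLeft then (normX z)⁻¹ else (normY z)⁻¹
  have hc (k : Fin p ⊕ Fin q) : c k ≠ 0 := by
    cases k
    · exact inv_ne_zero hx.ne'
    · exact inv_ne_zero hy.ne'
  have hextend : (fun w => extend f (c * w)) = extend f := funext fun w => extend_congr f <|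
    radial_eq_of_scale (inv_pos.2 hx) (inv_pos.2 hy) (fun _ => rfl) fun _ => rfl
  have hradial : c * z = radial z := by
    funext k
    cases k <;> exact inv_mul_eq_div _ _
  rw [← hradial, ← angular_comp_mul_left hc (fun i j => by simp only [c, he i j]), hextend]

theorem angular_sub_angular_cutoff_mul_extend (hpq : p + q ≠ 3) {f : SmoothM p q}
    (hf : f ∈ V p q) (z : Space p q) :
    angular Sum.inl (fun w => cutoff w * extend f w) z -
        angular Sum.inr (fun w => cutoff w * extend f w) z =
      yamabeConst p q * (cutoff z * extend f z) := by
  rw [angular_cutoff_mul_extend lieDeriv_rotGen_inl_cutoff f.2,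
    angular_cutoff_mul_extend lieDeriv_rotGen_inr_cutoff f.2]
  by_cases hz : z ∈ collar p q
  · obtain ⟨hx, hy⟩ := pos_of_mem_collar hz
    have hyam := hf ⟨radial z, radial_mem hx hy⟩
    rw [yamabe_apply hpq, lapX_eq_angular f.2, lapY_eq_angular f.2,
      ← extend_of_mem (f : spheres p q → ℂ), angular_extend_radial (fun _ _ => rfl) _ hx hy,
      angular_extend_radial (fun _ _ => rfl) _ hx hy,
      extend_congr _ (radial_of_mem (radial_mem hx hy))] at hyam
    linear_combination cutoff z * hyam
  · simp [cutoff_of_notMem_collar hz]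

theorem eq_zero_of_mem_V_of_antisymmetric (hp : 2 ≤ p) (hq : 2 ≤ q) {r : ℤ}
    (hr : (p : ℤ) - q = 2 * r) {g : SmoothM p q} (hg : g ∈ V p q)
    (hanti : ∀ z, (g : spheres p q → ℂ) (negM z) = -(-1) ^ r * (g : spheres p q → ℂ) z) :
    g = 0 := by
  have hW := eq_zero_of_angular_eq hp hq hr (contDiff_cutoff_mul_extend g.2)
    (hasCompactSupport_cutoff_mul _) (angular_sub_angular_cutoff_mul_extend (by omega) hg)
    fun z => by rw [cutoff_neg, extend_neg hanti, mul_left_comm]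
  refine Subtype.ext (funext fun z => ?_)
  simpa [cutoff_of_mem, extend_of_mem] using congrFun hW z

theorem m0_inv : (m0 p q)⁻¹ = m0 p q := inv_eq_of_mul_eq_one_left m0_mul_self

theorem mat_m0_mulVec (v : Space p q) : mat (m0 p q) *ᵥ v = -v := by
  change (-1 : Mat p q) *ᵥ v = -v
  rw [Matrix.neg_mulVec, Matrix.one_mulVec]

theorem varpi_m0_apply (lam : ℂ) (f : SmoothM p q) (z : spheres p q) :
    (varpi p q lam (m0 p q) f : spheres p q → ℂ) z = (f : spheres p q → ℂ) (negM z) := by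
  rw [← homExt_mat_inv_mulVec, m0_inv, mat_m0_mulVec]
  exact homExt_of_mem _ _ (negM z)

theorem apply_negM (hp : 2 ≤ p) (hq : 2 ≤ q) {r : ℤ} (hr : (p : ℤ) - q = 2 * r)
    {f : SmoothM p q} (hf : f ∈ V p q) (z : spheres p q) :
    (f : spheres p q → ℂ) (negM z) = (-1) ^ r * (f : spheres p q → ℂ) z := by
  set g : SmoothM p q := varpi p q (((p : ℂ) + q - 4) / 2) (m0 p q) f - (-1 : ℂ) ^ r • f
  have hg : g ∈ V p q := (V p q).sub_mem (varpi_mem_V (by omega) _ hf) ((V p q).smul_mem _ hf)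
  have hg_apply (z : spheres p q) : (g : spheres p q → ℂ) z =
      (f : spheres p q → ℂ) (negM z) - (-1) ^ r * (f : spheres p q → ℂ) z := by
    rw [← varpi_m0_apply (((p : ℂ) + q - 4) / 2)]
    rfl
  have hsq : (-1 : ℂ) ^ r * (-1) ^ r = 1 := by rw [← mul_zpow, neg_one_mul, neg_neg, one_zpow]
  have hg_zero := eq_zero_of_mem_V_of_antisymmetric hp hq hr hg fun z => by
    rw [hg_apply, hg_apply, negM_negM]
    linear_combination -(f : spheres p q → ℂ) z * hsq
  exact sub_eq_zero.1 ((hg_apply z).symm.trans (by rw [hg_zero]; rfl))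

end Parity

section LightCone

variable {p q : ℕ}

theorem coe_neg_one_zpow (r : ℤ) : ((((-1 : ℤˣ) ^ r : ℤˣ) : ℤ) : ℂ) = (-1) ^ r := by
  rcases Int.even_or_odd r with h | h <;> simp [h.neg_one_zpow]

theorem homExt_neg (a : ℂ) {f : spheres p q → ℂ} {c : ℂ} (h : ∀ z, f (negM z) = c * f z)
    (v : Space p q) : homExt a f (-v) = c * homExt a f v := by
  rw [homExt, normX_neg, extend_neg h, mul_left_comm, homExt]

theorem normY_pos (ξ : cone p q) : 0 < normY (ξ : Space p q) := by
  rw [← show normX (ξ : Space p q) = normY (ξ : Space p q) from ξ.2.1]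
  exact normX_pos ξ

theorem homExt_mem_S (a : ℂ) (ε : ℤˣ) {f : spheres p q → ℂ} (hf : f ∈ SmoothM p q)
    (h : ∀ z, f (negM z) = ((ε : ℤ) : ℂ) * f z) :
    (fun ξ : cone p q => homExt a f ξ) ∈ S p q a ε :=
  ⟨fun ξ => ⟨{v | 0 < normX v} ∩ {v | 0 < normY v},
    (isOpen_lt continuous_const continuous_normX).inter
      (isOpen_lt continuous_const continuous_normY), ⟨normX_pos ξ, normY_pos ξ⟩,
    homExt a f, fun _ hv => (contDiffAt_homExt a hf hv.1 hv.2).contDiffWithinAt, fun _ _ => rfl⟩,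
    fun _ ht ξ => homExt_smul a f ht ξ, fun ξ => homExt_neg a h ξ⟩

theorem homExt_varpi (lam : ℂ) (h : G p q) (f : SmoothM p q) (ξ : cone p q) :
    homExt (-lam) (varpi p q lam h f : spheres p q → ℂ) ξ =
      homExt (-lam) (f : spheres p q → ℂ) (h⁻¹ • ξ : cone p q) := by
  have hproj : (proj ξ : Space p q) = (nu (ξ : Space p q))⁻¹ • (ξ : Space p q) := radial_eq ξ
  have hξ : mat h⁻¹ *ᵥ (ξ : Space p q) =
      nu (ξ : Space p q) • (mat h⁻¹ *ᵥ (proj ξ : Space p q)) := by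
    rw [hproj, Matrix.mulVec_smul, smul_smul, mul_inv_cancel₀ (normX_pos ξ).ne', one_smul]
  rw [homExt_cone, ← homExt_mat_inv_mulVec, coe_smul, hξ, homExt_smul _ _ (normX_pos ξ)]

variable (p q) in
/-- The quadratic form of signature `(p, q)`. -/
def bil : LinearMap.BilinForm ℝ (Space p q) := Matrix.toBilin' (Ipq p q)

theorem bil_apply (v w : Space p q) : bil p q v w = v ⬝ᵥ (Ipq p q *ᵥ w) :=
  Matrix.toBilin'_apply' _ _ _

theorem Ipq_mulVec (v : Space p q) :
    Ipq p q *ᵥ v = Sum.elim (fun i => v (Sum.inl i)) (fun j => -v (Sum.inr j)) := by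
  funext k
  cases k <;> simp [LieAlgebra.Orthogonal.indefiniteDiagonal, Matrix.mulVec_diagonal]

theorem bil_eq_sum (v w : Space p q) : bil p q v w =
    ∑ i, v (Sum.inl i) * w (Sum.inl i) - ∑ j, v (Sum.inr j) * w (Sum.inr j) := by
  rw [bil_apply, Ipq_mulVec]
  simp [dotProduct, Fintype.sum_sum_type, sub_eq_add_neg]

theorem bil_comm (v w : Space p q) : bil p q v w = bil p q w v := by
  simp only [bil_eq_sum, mul_comm]

theorem bil_mulVec_mulVec (A : Mat p q) (v w : Space p q) :
    bil p q (A *ᵥ v) (A *ᵥ w) = v ⬝ᵥ ((Aᵀ * Ipq p q * A) *ᵥ w) := by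
  rw [bil_apply, ← Matrix.mulVec_mulVec, ← Matrix.mulVec_mulVec, Matrix.dotProduct_mulVec v,
    Matrix.vecMul_transpose]

theorem bil_mulVec (g : G p q) (v w : Space p q) :
    bil p q (mat g *ᵥ v) (mat g *ᵥ w) = bil p q v w := by
  rw [bil_mulVec_mulVec, show (mat g)ᵀ * Ipq p q * mat g = Ipq p q from g.2, bil_apply]

theorem bil_Ipq_mulVec (v w : Space p q) : bil p q (Ipq p q *ᵥ v) w = v ⬝ᵥ w := by
  rw [bil_eq_sum, Ipq_mulVec]
  simp [dotProduct, Fintype.sum_sum_type]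

theorem bil_self_of_mem (ξ : cone p q) : bil p q ξ ξ = 0 := by
  rw [bil_apply, form_eq, ξ.2.1, sub_self]

theorem mem_cone_of_bil {v : Space p q} (h : bil p q v v = 0) (h0 : v ≠ 0) : v ∈ cone p q := by
  refine ⟨?_, h0⟩
  rw [bil_apply, form_eq, sub_eq_zero] at h
  exact (pow_left_inj₀ (normX_nonneg _) (normY_nonneg _) two_ne_zero).1 h

theorem transpose_mul_Ipq_mul {A : Mat p q}
    (h : ∀ v w, bil p q (A *ᵥ v) (A *ᵥ w) = bil p q v w) : Aᵀ * Ipq p q * A = Ipq p q := by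
  refine (Matrix.toBilin' (R₁ := ℝ)).injective (LinearMap.ext fun v => LinearMap.ext fun w => ?_)
  rw [Matrix.toBilin'_apply', ← bil_mulVec_mulVec, h, bil]

/-- The element of `O(p,q)` given by a matrix which preserves the quadratic form. Its inverse is
`I_{p,q} ᵗA I_{p,q}`. -/
def ofMatrix (A : Mat p q) (h : ∀ v w, bil p q (A *ᵥ v) (A *ᵥ w) = bil p q v w) : G p q :=
  have hinv : (Ipq p q * Aᵀ * Ipq p q) * A = 1 := by
    rw [mul_assoc, mul_assoc, ← mul_assoc Aᵀ, transpose_mul_Ipq_mul h, Ipq_mul_self]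
  ⟨⟨A, Ipq p q * Aᵀ * Ipq p q, mul_eq_one_comm.1 hinv, hinv⟩, transpose_mul_Ipq_mul h⟩

/-- The matrix of the reflection in the hyperplane orthogonal to `w`. -/
def reflMat (w : Space p q) : Mat p q :=
  1 - (2 / bil p q w w) • Matrix.vecMulVec w (Ipq p q *ᵥ w)

theorem vecMulVec_Ipq_mulVec (u w v : Space p q) :
    Matrix.vecMulVec u (Ipq p q *ᵥ w) *ᵥ v = bil p q v w • u := by
  rw [Matrix.vecMulVec_mulVec, op_smul_eq_smul, bil_apply, dotProduct_comm]

theorem reflMat_mulVec (w v : Space p q) :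
    reflMat w *ᵥ v = v - (2 / bil p q w w * bil p q v w) • w := by
  rw [reflMat, Matrix.sub_mulVec, Matrix.one_mulVec, Matrix.smul_mulVec, vecMulVec_Ipq_mulVec,
    smul_smul]

/-- The reflection in the hyperplane orthogonal to `w`. -/
def refl (w : Space p q) (hw : bil p q w w ≠ 0) : G p q :=
  ofMatrix (reflMat w) fun u v => by
    simp only [reflMat_mulVec, map_sub, map_smul, LinearMap.sub_apply, LinearMap.smul_apply,
      smul_eq_mul, bil_comm w]
    field_simp
    ring

theorem bil_sub_self (ξ η : cone p q) :
    bil p q ((ξ : Space p q) - η) ((ξ : Space p q) - η) = -2 * bil p q ξ η := by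
  simp only [map_sub, LinearMap.sub_apply, bil_self_of_mem, bil_comm (η : Space p q) ξ]
  ring

theorem refl_smul {ξ η : cone p q}
    (h : bil p q ((ξ : Space p q) - η) ((ξ : Space p q) - η) ≠ 0) :
    refl ((ξ : Space p q) - (η : Space p q)) h • η = ξ := by
  rw [bil_sub_self] at h
  have hcoeff : 2 / bil p q ((ξ : Space p q) - η) ((ξ : Space p q) - η) *
      bil p q (η : Space p q) ((ξ : Space p q) - η) = -1 := by
    rw [bil_sub_self, map_sub, bil_self_of_mem, bil_comm (η : Space p q)]
    field_simp [right_ne_zero_of_mul h]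
    ring
  refine Subtype.ext ?_
  change reflMat _ *ᵥ (η : Space p q) = ξ
  rw [reflMat_mulVec, hcoeff, neg_one_smul, sub_neg_eq_add, add_sub_cancel]

theorem exists_smul_eq_of_bil_ne_zero {ξ η : cone p q} (h : bil p q ξ η ≠ 0) :
    ∃ g : G p q, g • η = ξ :=
  ⟨_, refl_smul (by rw [bil_sub_self]; exact mul_ne_zero (by norm_num) h)⟩

theorem exists_bil_ne_zero {ξ η : cone p q} (h : bil p q ξ η = 0) :
    ∃ ζ : cone p q, bil p q ζ ξ ≠ 0 ∧ bil p q ζ η ≠ 0 := by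
  have hpos (ξ : cone p q) : (ξ : Space p q) ⬝ᵥ (ξ : Space p q) ≠ 0 := fun h =>
    ξ.2.2 (dotProduct_self_eq_zero.1 h)
  -- The partner of `ξ` is its image under `(x, y) ↦ (x, -y)`, unless `η` is orthogonal to `ξ`.
  suffices ∃ v : Space p q, bil p q v v = 0 ∧ v ⬝ᵥ (ξ : Space p q) ≠ 0 ∧
      v ⬝ᵥ (η : Space p q) ≠ 0 by
    obtain ⟨v, hv, hvξ, hvη⟩ := this
    rw [← bil_Ipq_mulVec] at hvξ hvη
    have hIv : bil p q (Ipq p q *ᵥ v) (Ipq p q *ᵥ v) = 0 := by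
      rw [bil_Ipq_mulVec, ← bil_apply, hv]
    exact ⟨⟨_, mem_cone_of_bil hIv fun h0 => hvξ (by rw [h0, map_zero]; rfl)⟩, hvξ, hvη⟩
  by_cases horth : (ξ : Space p q) ⬝ᵥ (η : Space p q) = 0
  · refine ⟨ξ + η, ?_, ?_, ?_⟩
    · simp only [map_add, LinearMap.add_apply, bil_self_of_mem, bil_comm (η : Space p q) ξ, h,
        add_zero]
    · rw [add_dotProduct, dotProduct_comm (η : Space p q), horth, add_zero]
      exact hpos ξ
    · rw [add_dotProduct, horth, zero_add]
      exact hpos η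
  · exact ⟨ξ, bil_self_of_mem ξ, hpos ξ, horth⟩

theorem exists_smul_eq (ξ η : cone p q) : ∃ g : G p q, g • η = ξ := by
  by_cases h : bil p q ξ η = 0
  · obtain ⟨ζ, hζξ, hζη⟩ := exists_bil_ne_zero h
    obtain ⟨g, hg⟩ := exists_smul_eq_of_bil_ne_zero hζη
    obtain ⟨g', hg'⟩ := exists_smul_eq_of_bil_ne_zero (bil_comm (ζ : Space p q) ξ ▸ hζξ)
    exact ⟨g' * g, by rw [mul_smul, hg, hg']⟩
  · exact exists_smul_eq_of_bil_ne_zero h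

end LightCone

section Exp

variable {ι : Type*} [Fintype ι] [DecidableEq ι]

theorem hasSum_exp_mulVec (A : Matrix ι ι ℝ) (v : ι → ℝ) :
    HasSum (fun n : ℕ => (n.factorial : ℝ)⁻¹ • (A ^ n *ᵥ v)) (NormedSpace.exp A *ᵥ v) := by
  let _ : NormedRing (Matrix ι ι ℝ) := Matrix.linftyOpNormedRing
  let _ : NormedAlgebra ℝ (Matrix ι ι ℝ) := Matrix.linftyOpNormedAlgebra
  have hcont : Continuous fun M : Matrix ι ι ℝ => M *ᵥ v := by fun_prop
  have hsum := (NormedSpace.exp_series_hasSum_exp' (𝕂 := ℝ) A).map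
    (AddMonoidHom.mk' (fun M : Matrix ι ι ℝ => M *ᵥ v) fun M N => Matrix.add_mulVec M N v) hcont
  exact hsum.congr_fun fun n => (Matrix.smul_mulVec _ _ _).symm

theorem exp_mulVec_of_eigenvector {A : Matrix ι ι ℝ} {v : ι → ℝ} {c : ℝ} (h : A *ᵥ v = c • v) :
    NormedSpace.exp A *ᵥ v = Real.exp c • v := by
  have hpow (n : ℕ) : A ^ n *ᵥ v = c ^ n • v := by
    induction n with
    | zero => simp
    | succ n ih =>
      rw [pow_succ, ← Matrix.mulVec_mulVec, h, Matrix.mulVec_smul, ih, smul_smul, pow_succ,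
        mul_comm]
  have hsum := (NormedSpace.exp_series_hasSum_exp' (𝕂 := ℝ) c).smul_const v
  rw [← Real.exp_eq_exp_ℝ] at hsum
  exact (hasSum_exp_mulVec A v).unique (by simpa [hpow, smul_smul] using hsum)

theorem exp_mulVec_of_nilpotent {A : Matrix ι ι ℝ} {v w u : ι → ℝ} (hv : A *ᵥ v = w)
    (hw : A *ᵥ w = u) (hu : A *ᵥ u = 0) :
    NormedSpace.exp A *ᵥ v = v + w + (1 / 2 : ℝ) • u := by
  have hpow {n : ℕ} (hn : 3 ≤ n) : A ^ n *ᵥ v = 0 := by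
    obtain ⟨k, rfl⟩ := Nat.exists_eq_add_of_le' hn
    rw [pow_add, ← Matrix.mulVec_mulVec, pow_succ, pow_two, ← Matrix.mulVec_mulVec,
      ← Matrix.mulVec_mulVec, hv, hw, hu, Matrix.mulVec_zero]
  rw [← (hasSum_exp_mulVec A v).tsum_eq, tsum_eq_sum (s := Finset.range 3) fun n hn => by
    rw [hpow (by simpa using hn), smul_zero]]
  simp [Finset.sum_range_succ, hv, pow_two, ← Matrix.mulVec_mulVec, hw]

end Exp

section BasePoint

variable {p q : ℕ}

theorem bil_single_first [NeZero p] (v : Space p q) :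
    bil p q v (Pi.single (first p q) 1) = v (first p q) := by
  rw [bil_eq_sum]
  simp [first, Pi.single_apply]

theorem bil_single_last [NeZero q] (v : Space p q) :
    bil p q v (Pi.single (last p q) 1) = -v (last p q) := by
  rw [bil_eq_sum]
  simp [last, Pi.single_apply]

theorem mat_expG (X : Mat p q) (hX : X ∈ lieAlg p q) : mat (expG X hX) = NormedSpace.exp X := rfl

theorem expG_eq_one {X : Mat p q} (hX : X ∈ lieAlg p q) (h : X = 0) : expG X hX = 1 :=
  Subtype.ext (Units.ext (by
    change NormedSpace.exp X = 1
    rw [h, NormedSpace.exp_zero]))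

theorem m0_smul (ξ : cone p q) : m0 p q • ξ = negCone ξ :=
  Subtype.ext (mat_m0_mulVec _)

variable [NeZero p] [NeZero q]

theorem first_ne_last : first p q ≠ last p q := Sum.inl_ne_inr

variable (p q) in
/-- The point `ᵗ(1, 0, …, 0, -1)`, which together with the base point spans a hyperbolic plane. -/
def oppBase : Space p q := Pi.single (first p q) 1 - Pi.single (last p q) 1

theorem coe_base : (base p q : Space p q) = Pi.single (first p q) 1 + Pi.single (last p q) 1 := rfl

theorem single_first_eq : (Pi.single (first p q) 1 : Space p q) =
    (1 / 2 : ℝ) • ((base p q : Space p q) + oppBase p q) := by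
  rw [coe_base, oppBase]
  module

theorem single_last_eq : (Pi.single (last p q) 1 : Space p q) =
    (1 / 2 : ℝ) • ((base p q : Space p q) - oppBase p q) := by
  rw [coe_base, oppBase]
  module

theorem bil_base (v : Space p q) : bil p q v (base p q) = v (first p q) - v (last p q) := by
  rw [coe_base, map_add, bil_single_first, bil_single_last, sub_eq_add_neg]

theorem bil_oppBase (v : Space p q) : bil p q v (oppBase p q) = v (first p q) + v (last p q) := by
  rw [oppBase, map_sub, bil_single_first, bil_single_last, sub_neg_eq_add]

theorem base_first : (base p q : Space p q) (first p q) = 1 := by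
  simp [coe_base, first_ne_last]

theorem base_last : (base p q : Space p q) (last p q) = 1 := by
  simp [coe_base, first_ne_last.symm]

theorem oppBase_first : oppBase p q (first p q) = 1 := by
  simp [oppBase, first_ne_last]

theorem oppBase_last : oppBase p q (last p q) = -1 := by
  simp [oppBase, first_ne_last.symm]

theorem bil_oppBase_oppBase : bil p q (oppBase p q) (oppBase p q) = 0 := by
  rw [bil_oppBase, oppBase_first, oppBase_last, add_neg_cancel]

theorem bil_oppBase_base : bil p q (oppBase p q) (base p q) = 2 := by
  rw [bil_base, oppBase_first, oppBase_last]
  norm_num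

variable (p q) in
/-- `oppBase` as a point of the light cone. -/
def oppBaseCone : cone p q :=
  ⟨oppBase p q, mem_cone_of_bil bil_oppBase_oppBase fun h => by
    simpa [h] using oppBase_first (p := p) (q := q)⟩

theorem E_mulVec (v : Space p q) : E p q *ᵥ v =
    v (last p q) • Pi.single (first p q) 1 + v (first p q) • Pi.single (last p q) 1 := by
  rw [E, Matrix.add_mulVec]
  funext k
  simp [Matrix.mulVec, dotProduct, Matrix.single_apply, Pi.single_apply, ite_and, eq_comm]

theorem E_mulVec_first (v : Space p q) : (E p q *ᵥ v) (first p q) = v (last p q) := by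
  simp [E_mulVec, first_ne_last]

theorem E_mulVec_last (v : Space p q) : (E p q *ᵥ v) (last p q) = v (first p q) := by
  simp [E_mulVec, first_ne_last.symm]

theorem E_mulVec_base : E p q *ᵥ (base p q : Space p q) = base p q := by
  rw [E_mulVec, base_first, base_last, one_smul, one_smul, coe_base]

theorem E_mulVec_eq_zero {v : Space p q} (hf : v (first p q) = 0) (hl : v (last p q) = 0) :
    E p q *ᵥ v = 0 := by
  rw [E_mulVec, hf, hl, zero_smul, zero_smul, add_zero]

theorem eq_zero_of_E_mulVec_eq_two_smul {v : Space p q} (h : E p q *ᵥ v = (2 : ℝ) • v) :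
    v = 0 := by
  have hfirst : v (last p q) = 2 * v (first p q) := by rw [← E_mulVec_first v, h]; rfl
  have hlast : v (first p q) = 2 * v (last p q) := by rw [← E_mulVec_last v, h]; rfl
  rw [E_mulVec_eq_zero (by linarith) (by linarith)] at h
  exact (smul_eq_zero.1 h.symm).resolve_left two_ne_zero

theorem expE_smul_base (t : ℝ) :
    expE p q t • base p q = dilate (Real.exp t) (Real.exp_pos t) (base p q) := by
  apply Subtype.ext
  rw [coe_smul, expE, mat_expG]
  exact exp_mulVec_of_eigenvector (by rw [Matrix.smul_mulVec, E_mulVec_base])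

theorem expE_zero : expE p q 0 = 1 := expG_eq_one _ (zero_smul ℝ _)

theorem one_mem_Nmax : (1 : G p q) ∈ Nmax p q :=
  ⟨0, by simp [lieAlg], by simp, (expG_eq_one _ rfl).symm⟩

theorem Nmax_inv {n : G p q} (hn : n ∈ Nmax p q) : n⁻¹ ∈ Nmax p q := by
  obtain ⟨X, hX, hEX, rfl⟩ := hn
  have hnegX : -X ∈ lieAlg p q := by
    change (-X)ᵀ * Ipq p q + Ipq p q * (-X) = 0
    rw [Matrix.transpose_neg, neg_mul, mul_neg, ← neg_add,
      show Xᵀ * Ipq p q + Ipq p q * X = 0 from hX, neg_zero]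
  refine ⟨-X, hnegX, by rw [mul_neg, neg_mul, ← neg_sub', hEX],
    inv_eq_of_mul_eq_one_left (Subtype.ext (Units.ext ?_))⟩
  change NormedSpace.exp (-X) * NormedSpace.exp X = 1
  rw [← Matrix.exp_add_of_commute _ _ (Commute.neg_left (Commute.refl X)), neg_add_cancel,
    NormedSpace.exp_zero]

theorem Nmax_smul_base {n : G p q} (hn : n ∈ Nmax p q) : n • base p q = base p q := by
  obtain ⟨X, hX, hEX, rfl⟩ := hn
  have hzero : X *ᵥ (base p q : Space p q) = 0 := by
    refine eq_zero_of_E_mulVec_eq_two_smul ?_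
    have h := congrArg (· *ᵥ (base p q : Space p q)) hEX
    simp only [Matrix.sub_mulVec, ← Matrix.mulVec_mulVec, E_mulVec_base] at h
    rw [two_smul, ← sub_eq_iff_eq_add, h]
  apply Subtype.ext
  rw [coe_smul, mat_expG, exp_mulVec_of_eigenvector (c := 0) (by rw [hzero, zero_smul]),
    Real.exp_zero, one_smul]

theorem Mplus_smul_base {m : G p q} (hm : m ∈ Mplus p q) : m • base p q = base p q := by
  apply Subtype.ext
  rw [coe_smul, coe_base, Matrix.mulVec_add, hm.1, hm.2]

end BasePoint

section Character

variable {p q : ℕ} [NeZero p] [NeZero q]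

theorem chi_inv (ε : ℤˣ) (m : Mmax p q) : chi ε m⁻¹ = chi ε m := by
  rw [map_inv, Int.units_inv_eq_self]

theorem chi_of_mem (ε : ℤˣ) {m : Mmax p q} (hm : (m : G p q) ∈ Mplus p q) : chi ε m = 1 :=
  if_pos hm

theorem chi_of_notMem (ε : ℤˣ) {m : Mmax p q} (hm : (m : G p q) ∉ Mplus p q) : chi ε m = ε :=
  if_neg hm

theorem Mmax_smul_base_of_notMem {m : G p q} (hm : m ∈ Mmax p q) (hm' : m ∉ Mplus p q) :
    m • base p q = negCone (base p q) := by
  have h := Mplus_smul_base ((Mmax_cases hm).resolve_left hm')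
  rw [← one_mul m, ← m0_mul_self, mul_assoc, mul_smul, h, m0_smul]

theorem apply_Mmax_smul_base {a : ℂ} {ε : ℤˣ} {F : cone p q → ℂ} (hF : F ∈ S p q a ε) (g : G p q)
    (m : Mmax p q) : F (g • (m : G p q) • base p q) = ((chi ε m⁻¹ : ℤ) : ℂ) * F (g • base p q) := by
  rw [chi_inv]
  by_cases hm : (m : G p q) ∈ Mplus p q
  · rw [chi_of_mem ε hm, Mplus_smul_base hm, Units.val_one, Int.cast_one, one_mul]
  · rw [chi_of_notMem ε hm, Mmax_smul_base_of_notMem m.2 hm, smul_negCone, hF.2.2]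

theorem exp_mul_eq_cpow (t : ℝ) (a : ℂ) : Complex.exp (t * a) = ((Real.exp t : ℝ) : ℂ) ^ a := by
  rw [Complex.cpow_def_of_ne_zero (by exact_mod_cast (Real.exp_pos t).ne'),
    ← Complex.ofReal_log (Real.exp_pos t).le, Real.log_exp]

theorem pullback_mem_Ind {lam a : ℂ} (ha : -(lam + rho p q) = a) {ε : ℤˣ} {F : cone p q → ℂ}
    (hF : F ∈ S p q a ε) : (fun g : G p q => F (g • base p q)) ∈ Ind p q lam ε := by
  refine ⟨?_, fun g m t n hn => ?_⟩
  · refine IsSmooth.comp (f := F) hF.1 (fun g => g • base p q)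
      (fun A i => ∑ j, A i j * (base p q : Space p q) j)
      (fun g => ⟨Set.univ, isOpen_univ, trivial, ContDiff.contDiffOn ?_⟩) fun g => rfl
    fun_prop
  · simp only [mul_smul]
    rw [Nmax_smul_base hn, expE_smul_base, smul_dilate, smul_dilate, hF.2.1, ha,
      apply_Mmax_smul_base hF, exp_mul_eq_cpow, mul_left_comm, mul_assoc]

end Character

section Stabilizer

variable {p q : ℕ}

theorem mem_lieAlg_of_skew {X : Mat p q}
    (h : ∀ v w, bil p q (X *ᵥ v) w + bil p q v (X *ᵥ w) = 0) : X ∈ lieAlg p q := by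
  refine (Matrix.toBilin' (R₁ := ℝ)).injective (LinearMap.ext fun v => LinearMap.ext fun w => ?_)
  rw [Matrix.toBilin'_apply', Matrix.add_mulVec, dotProduct_add, ← Matrix.mulVec_mulVec,
    ← Matrix.mulVec_mulVec, Matrix.dotProduct_mulVec v, Matrix.vecMul_transpose, ← bil_apply,
    ← bil_apply, h, map_zero, LinearMap.zero_apply, LinearMap.zero_apply]

variable [NeZero p] [NeZero q]

/-- The matrix `v ↦ ⟨v, ξ°⟩ u - ⟨v, u⟩ ξ°`. For `u` orthogonal to the hyperbolic plane of `ξ°` it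
lies in the Lie algebra of `N`. -/
def nilMat (u : Space p q) : Mat p q :=
  Matrix.vecMulVec u (Ipq p q *ᵥ (base p q : Space p q)) -
    Matrix.vecMulVec (base p q : Space p q) (Ipq p q *ᵥ u)

theorem nilMat_mulVec (u v : Space p q) :
    nilMat u *ᵥ v = bil p q v (base p q) • u - bil p q v u • (base p q : Space p q) := by
  rw [nilMat, Matrix.sub_mulVec, vecMulVec_Ipq_mulVec, vecMulVec_Ipq_mulVec]

theorem nilMat_mem (u : Space p q) : nilMat u ∈ lieAlg p q := by
  refine mem_lieAlg_of_skew fun v w => ?_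
  simp only [nilMat_mulVec, map_sub, map_smul, LinearMap.sub_apply, LinearMap.smul_apply,
    smul_eq_mul, bil_comm u w, bil_comm (base p q : Space p q) w]
  ring

theorem bil_E_mulVec (v w : Space p q) : bil p q (E p q *ᵥ v) w = -bil p q v (E p q *ᵥ w) := by
  rw [bil_comm, E_mulVec, E_mulVec]
  simp only [map_add, map_smul, bil_single_first, bil_single_last, smul_eq_mul]
  ring

theorem nilMat_bracket {u : Space p q} (hu : E p q *ᵥ u = 0) :
    E p q * nilMat u - nilMat u * E p q = nilMat u := by
  refine Matrix.mulVec_injective (funext fun v => ?_)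
  change (E p q * nilMat u - nilMat u * E p q) *ᵥ v = nilMat u *ᵥ v
  rw [Matrix.sub_mulVec, ← Matrix.mulVec_mulVec, ← Matrix.mulVec_mulVec]
  simp only [nilMat_mulVec, Matrix.mulVec_sub, Matrix.mulVec_smul, hu, E_mulVec_base, bil_E_mulVec,
    map_zero, smul_zero, neg_zero, zero_smul]
  module

theorem exp_nilMat_mulVec_oppBase {u : Space p q} (hb : bil p q u (base p q) = 0)
    (hc : bil p q u (oppBase p q) = 0) : NormedSpace.exp (nilMat u) *ᵥ oppBase p q =
      oppBase p q + (2 : ℝ) • u - bil p q u u • (base p q : Space p q) := by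
  have hopp : nilMat u *ᵥ oppBase p q = (2 : ℝ) • u := by
    rw [nilMat_mulVec, bil_oppBase_base, bil_comm, hc, zero_smul, sub_zero]
  have hu : nilMat u *ᵥ ((2 : ℝ) • u) = (-2 * bil p q u u) • (base p q : Space p q) := by
    rw [Matrix.mulVec_smul, nilMat_mulVec, hb]
    module
  have hbase : nilMat u *ᵥ ((-2 * bil p q u u) • (base p q : Space p q)) = 0 := by
    rw [Matrix.mulVec_smul, nilMat_mulVec, bil_self_of_mem, bil_comm (base p q : Space p q) u, hb]
    module
  rw [exp_mulVec_of_nilpotent hopp hu hbase]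
  module

theorem exists_eq_oppBase_add {ζ : Space p q} (hζ : bil p q ζ ζ = 0)
    (hζb : bil p q ζ (base p q) = 2) :
    ∃ u : Space p q, bil p q u (base p q) = 0 ∧ bil p q u (oppBase p q) = 0 ∧
      ζ = oppBase p q + (2 : ℝ) • u - bil p q u u • (base p q : Space p q) := by
  have hbb := bil_self_of_mem (base p q)
  have hcb := bil_oppBase_base (p := p) (q := q)
  have hbc := bil_comm (base p q) (oppBase p q) |>.trans hcb
  have hcc := bil_oppBase_oppBase (p := p) (q := q)
  set b : Space p q := (base p q : Space p q)
  set c : Space p q := oppBase p q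
  obtain ⟨α, hα⟩ : ∃ α : ℝ, bil p q ζ c = 2 * α := ⟨_, (mul_div_cancel₀ _ two_ne_zero).symm⟩
  obtain ⟨u, rfl⟩ : ∃ u : Space p q, ζ = c + (2 : ℝ) • u + α • b :=
    ⟨(1 / 2 : ℝ) • (ζ - c - α • b), by module⟩
  simp only [map_add, map_smul, LinearMap.add_apply, LinearMap.smul_apply, smul_eq_mul,
    hbb, hcb, hbc, hcc, bil_comm b u, bil_comm c u] at hζ hζb hα
  have hub : bil p q u b = 0 := by linarith
  have huc : bil p q u c = 0 := by linarith
  rw [hub, huc] at hζ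
  refine ⟨u, hub, huc, ?_⟩
  rw [show α = -bil p q u u by linarith]
  module

theorem exists_Nmax_mulVec {ζ : Space p q} (hζ : bil p q ζ ζ = 0)
    (hζb : bil p q ζ (base p q) = 2) : ∃ n ∈ Nmax p q, mat n *ᵥ oppBase p q = ζ := by
  obtain ⟨u, hub, huc, rfl⟩ := exists_eq_oppBase_add hζ hζb
  have hEu : E p q *ᵥ u = 0 := by
    rw [bil_base] at hub
    rw [bil_oppBase] at huc
    exact E_mulVec_eq_zero (by linarith) (by linarith)
  exact ⟨expG (nilMat u) (nilMat_mem u), ⟨_, nilMat_mem u, nilMat_bracket hEu, rfl⟩,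
    exp_nilMat_mulVec_oppBase hub huc⟩

theorem mem_Mplus {m : G p q} (hb : mat m *ᵥ (base p q : Space p q) = base p q)
    (hc : mat m *ᵥ oppBase p q = oppBase p q) : m ∈ Mplus p q := by
  refine ⟨?_, ?_⟩
  · rw [single_first_eq, Matrix.mulVec_smul, Matrix.mulVec_add, hb, hc]
  · rw [single_last_eq, Matrix.mulVec_smul, Matrix.mulVec_sub, hb, hc]

theorem exists_eq_mul_of_smul_base {g : G p q} (hg : g • base p q = base p q) :
    ∃ m ∈ Mplus p q, ∃ n ∈ Nmax p q, g = m * n := by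
  have hgb : mat g *ᵥ (base p q : Space p q) = base p q := congrArg Subtype.val hg
  obtain ⟨n, hn, hnc⟩ := exists_Nmax_mulVec (ζ := mat g⁻¹ *ᵥ oppBase p q)
    (by rw [bil_mulVec, bil_oppBase_oppBase])
    (by
      rw [← bil_mulVec g, Matrix.mulVec_mulVec, mat_mul_inv, Matrix.one_mulVec, hgb,
        bil_oppBase_base])
  refine ⟨g * n, mem_Mplus ?_ ?_, n⁻¹, Nmax_inv hn, (mul_inv_cancel_right g n).symm⟩
  · exact congrArg Subtype.val (by rw [mul_smul, Nmax_smul_base hn, hg] :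
      (g * n) • base p q = base p q)
  · rw [show mat (g * n) = mat g * mat n from rfl, ← Matrix.mulVec_mulVec, hnc,
      Matrix.mulVec_mulVec, mat_mul_inv, Matrix.one_mulVec]

end Stabilizer

section Descent

variable {p q : ℕ}

theorem contDiff_bil_self : ContDiff ℝ ∞ fun v : Space p q => bil p q v v := by
  simp only [bil_eq_sum]
  fun_prop

theorem contDiffOn_reflMat :
    ContDiffOn ℝ ∞ (fun w i j => reflMat w i j : Space p q → _) {w | bil p q w w ≠ 0} := by
  refine contDiffOn_pi.2 fun i => contDiffOn_pi.2 fun j => ?_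
  simp only [reflMat, Matrix.sub_apply, Matrix.smul_apply, Matrix.vecMulVec_apply, smul_eq_mul]
  have hI : ContDiff ℝ ∞ fun w : Space p q => (Ipq p q *ᵥ w) j :=
    contDiff_pi.1 (contDiff_mulVec (Ipq p q)) j
  exact contDiffOn_const.sub ((contDiffOn_const.div contDiff_bil_self.contDiffOn fun _ hw => hw).mul
    ((contDiff_apply ℝ ℝ i).mul hI).contDiffOn)

variable [NeZero p] [NeZero q]

/-- The reflection carrying `ξ°` to a point of `Ξ` not orthogonal to it depends smoothly on that
point. -/
theorem exists_localSection (ξ₀ : cone p q) :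
    ∃ U : Set (Space p q), IsOpen U ∧ (ξ₀ : Space p q) ∈ U ∧
      ∃ s : Space p q → Fin p ⊕ Fin q → Fin p ⊕ Fin q → ℝ, ContDiffOn ℝ ∞ s U ∧
        ∀ ξ : cone p q, (ξ : Space p q) ∈ U →
          ∃ g : G p q, g • base p q = ξ ∧ entries p q g = s ξ := by
  obtain ⟨g, hg⟩ := exists_smul_eq (oppBaseCone p q) ξ₀
  set w : Space p q → Space p q := fun v => mat g *ᵥ v - base p q
  have hw : ContDiff ℝ ∞ w := (contDiff_mulVec _).sub contDiff_const
  refine ⟨w ⁻¹' {w | bil p q w w ≠ 0},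
    (isOpen_ne_fun contDiff_bil_self.continuous continuous_const).preimage hw.continuous, ?_,
    fun v i j => (mat g⁻¹ * reflMat (w v)) i j, ?_, fun ξ hξ => ⟨g⁻¹ * refl (w ξ) hξ, ?_, rfl⟩⟩
  · have hw₀ : w ξ₀ = (oppBaseCone p q : Space p q) - base p q := by rw [← hg]; rfl
    rw [Set.mem_preimage, hw₀, Set.mem_ofPred_eq, bil_sub_self, oppBaseCone, bil_oppBase_base]
    norm_num
  · have hrefl := contDiffOn_reflMat.comp hw.contDiffOn (Set.mapsTo_preimage w _)
    refine contDiffOn_pi.2 fun i => contDiffOn_pi.2 fun j => ?_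
    simp only [Matrix.mul_apply]
    exact ContDiffOn.sum fun k _ =>
      contDiffOn_const.mul (contDiffOn_pi.1 (contDiffOn_pi.1 hrefl k) j)
  · rw [mul_smul, inv_smul_eq_iff]
    exact refl_smul (ξ := g • ξ) hξ

theorem isSmooth_of_isSmooth_smul_base {F : cone p q → ℂ}
    (hF : IsSmooth (entries p q) fun g => F (g • base p q)) :
    IsSmooth (Subtype.val : cone p q → Space p q) F := by
  intro ξ₀
  obtain ⟨U, hU, hξ₀, s, hs, hsec⟩ := exists_localSection ξ₀
  obtain ⟨g₀, -, hg₀⟩ := hsec ξ₀ hξ₀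
  obtain ⟨O, hO, hsO, H, hH, hFH⟩ := hF g₀
  rw [hg₀] at hsO
  refine ⟨U ∩ s ⁻¹' O, hs.continuousOn.isOpen_inter_preimage hU hO, ⟨hξ₀, hsO⟩,
    fun v => H (s v), hH.comp (hs.mono Set.inter_subset_left) fun _ hv => hv.2, ?_⟩
  rintro ξ ⟨hξU, hξO⟩
  obtain ⟨g, hgξ, hgs⟩ := hsec ξ hξU
  rw [Set.mem_preimage, ← hgs] at hξO
  have hFg : F (g • base p q) = H (entries p q g) := hFH g hξO
  rwa [hgξ, hgs] at hFg

theorem Ind_apply_mul_expE {lam : ℂ} {ε : ℤˣ} {f : G p q → ℂ} (hf : f ∈ Ind p q lam ε)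
    (g : G p q) (t : ℝ) :
    f (g * expE p q t) = Complex.exp (t * -(lam + rho p q)) * f g := by
  simpa using hf.2 g 1 t 1 one_mem_Nmax

theorem Ind_apply_mul_mul {lam : ℂ} {ε : ℤˣ} {f : G p q → ℂ} (hf : f ∈ Ind p q lam ε)
    (g : G p q) (m : Mmax p q) {n : G p q} (hn : n ∈ Nmax p q) :
    f (g * m * n) = ((chi ε m : ℤ) : ℂ) * f g := by
  simpa [expE_zero, chi_inv] using hf.2 g m 0 n hn

theorem Ind_apply_mul_m0 {lam : ℂ} {ε : ℤˣ} {f : G p q → ℂ} (hf : f ∈ Ind p q lam ε)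
    (g : G p q) : f (g * m0 p q) = ((ε : ℤ) : ℂ) * f g := by
  have h := Ind_apply_mul_mul hf g ⟨m0 p q, Subgroup.subset_closure (Or.inr rfl)⟩ one_mem_Nmax
  rwa [chi_of_notMem ε m0_not_mem, mul_one] at h

theorem apply_eq_of_smul_base_eq {lam : ℂ} {ε : ℤˣ} {f : G p q → ℂ} (hf : f ∈ Ind p q lam ε)
    {g h : G p q} (hgh : g • base p q = h • base p q) : f g = f h := by
  obtain ⟨m, hm, n, hn, hmn⟩ := exists_eq_mul_of_smul_base (g := h⁻¹ * g)
    (by rw [mul_smul, hgh, inv_smul_smul])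
  have hg : g = h * m * n := by rw [mul_assoc, ← hmn, mul_inv_cancel_left]
  have hmul := Ind_apply_mul_mul hf h ⟨m, Subgroup.subset_closure (Or.inl hm)⟩ hn
  rwa [chi_of_mem ε hm, Units.val_one, Int.cast_one, one_mul, ← hg] at hmul

/-- The function on the light cone which pulls back to a given element of `Ind` along
`g ↦ g ξ°`. -/
def descend (f : G p q → ℂ) (ξ : cone p q) : ℂ := f (exists_smul_eq ξ (base p q)).choose

theorem descend_smul_base {lam : ℂ} {ε : ℤˣ} {f : G p q → ℂ} (hf : f ∈ Ind p q lam ε)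
    (g : G p q) : descend f (g • base p q) = f g :=
  apply_eq_of_smul_base_eq hf (exists_smul_eq (g • base p q) (base p q)).choose_spec

theorem descend_mem_S {lam a : ℂ} (ha : -(lam + rho p q) = a) {ε : ℤˣ} {f : G p q → ℂ}
    (hf : f ∈ Ind p q lam ε) : descend f ∈ S p q a ε := by
  refine ⟨isSmooth_of_isSmooth_smul_base ?_, fun t ht ξ => ?_, fun ξ => ?_⟩
  · rw [show (fun g => descend f (g • base p q)) = f from funext (descend_smul_base hf)]
    exact hf.1
  · obtain ⟨g, rfl⟩ := exists_smul_eq ξ (base p q)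
    have hdilate : dilate t ht (g • base p q) = (g * expE p q (Real.log t)) • base p q := by
      simp only [mul_smul, expE_smul_base, smul_dilate, Real.exp_log ht]
    rw [hdilate, descend_smul_base hf, descend_smul_base hf, Ind_apply_mul_expE hf, ha,
      exp_mul_eq_cpow, Real.exp_log ht]
  · obtain ⟨g, rfl⟩ := exists_smul_eq ξ (base p q)
    rw [← smul_negCone, ← m0_smul, ← mul_smul, descend_smul_base hf, descend_smul_base hf,
      Ind_apply_mul_m0 hf]

/-- The isomorphism `F ↦ (g ↦ F (g ξ°))` of `S^{a,ε}(Ξ)` with the degenerate principal series. -/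
def coneRepEquiv {lam a : ℂ} (ha : -(lam + rho p q) = a) (ε : ℤˣ) :
    Representation.Equiv (coneRep p q a ε) (indRep p q lam ε) :=
  .mk
    { toFun := fun F => ⟨fun g => (F : cone p q → ℂ) (g • base p q), pullback_mem_Ind ha F.2⟩
      map_add' := fun _ _ => rfl
      map_smul' := fun _ _ => rfl
      invFun := fun f => ⟨descend f, descend_mem_S ha f.2⟩
      left_inv := fun F => Subtype.ext (funext fun ξ =>
        congrArg (F : cone p q → ℂ) (exists_smul_eq ξ (base p q)).choose_spec)
      right_inv := fun f => Subtype.ext (funext fun g => descend_smul_base f.2 g) }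
    fun h => LinearMap.ext fun F => Subtype.ext (funext fun g =>
      congrArg (F : cone p q → ℂ) (mul_smul h⁻¹ g (base p q)).symm)

end Descent

section Embedding

variable {p q : ℕ}

/-- `V^{p,q}` as a subrepresentation of `C^∞(M)`. -/
def Vrep (hpq : p + q ≠ 3) : Subrepresentation (varpi p q (((p : ℂ) + q - 4) / 2)) where
  toSubmodule := V p q
  apply_mem_toSubmodule g _ hv := varpi_mem_V hpq g hv

/-- The homogeneous extension to the light cone of the solutions of the Yamabe equation, where
`r = (p - q) / 2`. -/
def toConeMap (hp : 2 ≤ p) (hq : 2 ≤ q) {r : ℤ} (hr : (p : ℤ) - q = 2 * r) :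
    Representation.IntertwiningMap (Vrep (show p + q ≠ 3 by omega)).toRepresentation
      (coneRep p q (-(((p : ℂ) + q - 4) / 2)) ((-1) ^ r)) where
  toFun f := ⟨fun ξ => homExt (-(((p : ℂ) + q - 4) / 2)) (f : SmoothM p q).1 ξ,
    homExt_mem_S _ _ (f : SmoothM p q).2 fun z => by
      rw [coe_neg_one_zpow, apply_negM hp hq hr f.2 z]⟩
  map_add' f g := by
    refine Subtype.ext (funext fun ξ => ?_)
    change homExt _ ((f : SmoothM p q).1 + (g : SmoothM p q).1) _ = homExt _ _ _ + homExt _ _ _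
    simp only [homExt, extend_add, mul_add]
  map_smul' c f := by
    refine Subtype.ext (funext fun ξ => ?_)
    change homExt _ (c • (f : SmoothM p q).1) _ = c * homExt _ _ _
    simp only [homExt, extend_smul, smul_eq_mul, mul_left_comm]
  isIntertwining' h := LinearMap.ext fun f => Subtype.ext (funext fun ξ => homExt_varpi _ h f ξ)

theorem toConeMap_apply_toCone (hp : 2 ≤ p) (hq : 2 ≤ q) {r : ℤ} (hr : (p : ℤ) - q = 2 * r)
    (f : V p q) (z : spheres p q) :
    (toConeMap hp hq hr f : cone p q → ℂ) (toCone z) = (f : SmoothM p q).1 z :=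
  homExt_of_mem _ _ z

theorem toConeMap_injective (hp : 2 ≤ p) (hq : 2 ≤ q) {r : ℤ} (hr : (p : ℤ) - q = 2 * r) :
    Function.Injective (toConeMap hp hq hr) := fun f g hfg =>
  Subtype.ext (Subtype.ext (funext fun z => by
    rw [← toConeMap_apply_toCone hp hq hr f z, ← toConeMap_apply_toCone hp hq hr g z, hfg]))

end Embedding

end OPQ

end

theorem lemma3p7p2 (p q : ℕ) [NeZero p] [NeZero q] (hp : 2 ≤ p) (hq : 2 ≤ q)
    (hpq : Even (p + q)) :
    ∃ W : Subrepresentation (OPQ.varpi p q (((p : ℂ) + q - 4) / 2)),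
      W.toSubmodule = OPQ.V p q ∧
      ∃ J : Representation.IntertwiningMap W.toRepresentation
          (OPQ.coneRep p q (-(((p : ℂ) + q - 4) / 2)) ((-1) ^ (((p : ℤ) - q) / 2))),
        Function.Injective J ∧
        (∀ (f : W.toSubmodule) (z : OPQ.spheres p q),
          (J f : OPQ.cone p q → ℂ) (OPQ.toCone z) = (f : OPQ.SmoothM p q).1 z) ∧
        ∃ Φ : Representation.Equiv
            (OPQ.coneRep p q (-(((p : ℂ) + q - 4) / 2)) ((-1) ^ (((p : ℤ) - q) / 2)))
            (OPQ.indRep p q (-1) ((-1) ^ (((p : ℤ) - q) / 2))),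
          (∀ (F : OPQ.S p q (-(((p : ℂ) + q - 4) / 2)) ((-1) ^ (((p : ℤ) - q) / 2)))
              (g : OPQ.G p q),
            (Φ F : OPQ.G p q → ℂ) g = (F : OPQ.cone p q → ℂ) (g • OPQ.base p q)) ∧
          ∃ T : Representation.IntertwiningMap W.toRepresentation
              (OPQ.indRep p q (-1) ((-1) ^ (((p : ℤ) - q) / 2))),
            Function.Injective T ∧ ∀ f : W.toSubmodule, T f = Φ (J f) := by
  have hr : (p : ℤ) - q = 2 * (((p : ℤ) - q) / 2) := by
    obtain ⟨k, hk⟩ := hpq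
    omega
  have ha : -((-1 : ℂ) + OPQ.rho p q) = -(((p : ℂ) + q - 4) / 2) := by
    rw [OPQ.rho]
    ring
  let J := OPQ.toConeMap hp hq hr
  let Φ := OPQ.coneRepEquiv ha ((-1) ^ (((p : ℤ) - q) / 2))
  have hJ : Function.Injective J := OPQ.toConeMap_injective hp hq hr
  exact ⟨OPQ.Vrep (by omega), rfl, J, hJ, OPQ.toConeMap_apply_toCone hp hq hr, Φ,
    fun _ _ => rfl, Φ.toIntertwiningMap.comp J, (EquivLike.injective Φ).comp hJ, fun _ => rfl⟩
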